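/- Let $G$ be a compact Lie group and let $\phi$ be a finite directed graph: finite sets $E$ of edges and $V$ of vertices with maps $s,t\colon E\to V$. Put $S(v)=s^{-1}(v)$ and $T(v)=t^{-1}(v)$. Let $P$ be a principal $G$-bundle over the discrete space $V$, with fibers $P_v$. A connection is a family $A=(A_e)_{e\in E}$ of smooth $G$-equivariant maps $A_e\colon P_{s(e)}\to P_{t(e)}$; let $\mathcal A$ be the space of connections. A gauge transformation is a family $g=(g_v)_{v\in V}$ of $G$-equivariant diffeomorphisms $g_v\colon P_v\to P_v$; these form a group $\mathcal G$, which acts on $\mathcal A$ by $(gA)_e=g_{t(e)}A_eg_{s(e)}^{-1}$. A trivialization $\tau$ of $P$ (a $G$-equivariant diffeomorphism $P_v\cong G$ for each $v$) turns $A_e$ into left multiplication by an element $A_e^\tau\in G$ and so identifies $\mathcal A$ with $G^E$; let $\mu$ be the measure on $\mathcal A$ that corresponds to the product of the normalized Haar measures, and let $L^2(\mathcal A/\mathcal G)$ be taken with respect to the pushforward of $\mu$ to $\mathcal A/\mathcal G$. Let $\Lambda$ be a set of irreducible unitary representations of $G$, one for each equivalence class. For $\rho\in\Lambda$ let $\rho^*\in\Lambda$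 be the member equivalent to the dual of $\rho$, and fix a unitary equivalence $J_\rho$ from $\rho^*$ to the dual of $\rho$. For $\rho\in\Lambda^E$ and $v\in V$ let $\mathrm{Inv}(v,\rho)$ be the subspace of $G$-invariant elements of $\bigotimes_{e\in S(v)}\rho_e\otimes\bigotimes_{e\in T(v)}\rho_e^*$. For a trivialization $\tau$ let $$L_{\tau,\rho}\colon\ \bigotimes_{v\in V}\Bigl(\bigotimes_{e\in S(v)}\rho_e\otimes\bigotimes_{e\in T(v)}\rho_e^*\Bigr)\longrightarrow\{\text{functions }\mathcal A\to\mathbb C\}$$ be the linear map that sends $\bigotimes_v\bigl(\bigotimes_{e\in S(v)}x_e\otimes\bigotimes_{e\in T(v)}y_e\bigr)$, for $x_e\in\rho_e$ and $y_e\in\rho_e^*$, to the function $A\mapsto\prod_{e\in E}(\dim\rho_e)^{1/2}\,(J_{\rho_e}y_e)\bigl(\rho_e(A^\tau_e)x_e\bigr)$. Then: (1) The measure $\mu$ does not depend on the trivialization by which it is defined. (2) There is an isomorphism of Hilbert spaces $$U\colon\ L^2(\mathcal A/\mathcal G)\ \cong\ \bigoplus_{\rho\in\Lambda^E}\ \bigotimes_{v\in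 V}\mathrm{Inv}(v,\rho)$$ that is independent of the trivialization: for every trivialization $\tau$, every $\rho\in\Lambda^E$ and all $\iota_v\in\mathrm{Inv}(v,\rho)$, the element $\Psi_{\rho,\iota}=U^{-1}\bigl(\bigotimes_v\iota_v\bigr)$, pulled back to $\mathcal A$, is equal $\mu$-almost everywhere to the function $L_{\tau,\rho}\bigl(\bigotimes_v\iota_v\bigr)$. (3) If an orthonormal (Hilbert) basis of $\mathrm{Inv}(v,\rho)$ is chosen for all $\rho\in\Lambda^E$ and $v\in V$, then the vectors $\Psi_{\rho,\iota}$, where $\rho$ runs over $\Lambda^E$ and each $\iota_v$ over the chosen basis of $\mathrm{Inv}(v,\rho)$, form an orthonormal basis of $L^2(\mathcal A/\mathcal G)$. -/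

import Mathlib

open MeasureTheory
open scoped Manifold ContDiff TensorProduct InnerProductSpace

noncomputable section

/-! ### Hilbert tensor product of a finite family -/

namespace SpinNet

/-- The tensor product of a finite family of complex inner product spaces, with the inner product
`⟪⨂ xᵢ, ⨂ yᵢ⟫ = ∏ ⟪xᵢ, yᵢ⟫`. (A type of its own, since `⨂[ℂ] i, H i` carries the projective
norm.) For finite-dimensional factors, the only ones that occur below, it is complete. -/
def HTensor {ι : Type*} (H : ι → Type*) [∀ i, NormedAddCommGroup (H i)]
    [∀ i, InnerProductSpace ℂ (H i)] : Type _ :=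
  PiTensorProduct ℂ H

namespace HTensor

variable {ι : Type*} {H K : ι → Type*} [∀ i, NormedAddCommGroup (H i)]
  [∀ i, InnerProductSpace ℂ (H i)] [∀ i, NormedAddCommGroup (K i)]
  [∀ i, InnerProductSpace ℂ (K i)]

instance : AddCommGroup (HTensor H) := inferInstanceAs (AddCommGroup (PiTensorProduct ℂ H))

instance : Module ℂ (HTensor H) := inferInstanceAs (Module ℂ (PiTensorProduct ℂ H))

/-- The pure tensor `⨂ xᵢ`, as a multilinear map of the family `x`. -/
def tprod : MultilinearMap ℂ H (HTensor H) := PiTensorProduct.tprod ℂ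

/-- The tensor product of a family of linear maps. -/
def map (f : ∀ i, H i →ₗ[ℂ] K i) : HTensor H →ₗ[ℂ] HTensor K := PiTensorProduct.map f

theorem map_tprod (f : ∀ i, H i →ₗ[ℂ] K i) (x : ∀ i, H i) :
    map f (tprod x) = tprod fun i => f i (x i) :=
  PiTensorProduct.map_tprod f x

theorem map_map {L : ι → Type*} [∀ i, NormedAddCommGroup (L i)] [∀ i, InnerProductSpace ℂ (L i)]
    (f : ∀ i, H i →ₗ[ℂ] K i) (g : ∀ i, K i →ₗ[ℂ] L i) (x : HTensor H) :
    map g (map f x) = map (fun i => g i ∘ₗ f i) x :=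
  (LinearMap.congr_fun (PiTensorProduct.map_comp g f) x).symm

theorem induction {p : HTensor H → Prop} (x : HTensor H)
    (hs : ∀ (c : ℂ) (f : ∀ i, H i), p (c • tprod f)) (ha : ∀ x y, p x → p y → p (x + y)) : p x :=
  PiTensorProduct.induction_on (motive := p) x (fun c f => hs c f) (fun x y => ha x y)

/-- For a fixed family `x`, the multilinear functional `y ↦ ∏ ⟪xᵢ, yᵢ⟫`. -/
def innerPure [Fintype ι] (x : ∀ i, H i) : MultilinearMap ℂ H ℂ :=
  (MultilinearMap.mkPiAlgebra ℂ ι ℂ).compLinearMap fun i => (innerSL ℂ (x i)).toLinearMap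

theorem innerPure_apply [Fintype ι] (x y : ∀ i, H i) :
    innerPure x y = ∏ i, ⟪x i, y i⟫_ℂ := by
  simp [innerPure]

/-- For a fixed family `y`, the conjugate-linear functional `x ↦ ⟪x, ⨂ yᵢ⟫`. -/
def innerLeft [Fintype ι] (y : ∀ i, H i) : HTensor H →ₗ⋆[ℂ] ℂ :=
  (starLinearEquiv ℂ (A := ℂ)).toLinearMap.comp
    (PiTensorProduct.lift (innerPure y) : HTensor H →ₗ[ℂ] ℂ)

theorem innerLeft_tprod [Fintype ι] (x y : ∀ i, H i) : innerLeft y (tprod x) = innerPure x y := by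
  change starRingEnd ℂ ((PiTensorProduct.lift (innerPure y)) (PiTensorProduct.tprod ℂ x)) = _
  rw [PiTensorProduct.lift.tprod, innerPure_apply, innerPure_apply, map_prod]
  simp only [inner_conj_symm]

theorem antilinear_ext {f g : HTensor H →ₗ⋆[ℂ] ℂ} (h : ∀ x, f (tprod x) = g (tprod x)) :
    f = g := by
  ext x
  induction x using HTensor.induction with
  | hs c x => simp [h]
  | ha x y hx hy => simp [hx, hy]

/-- The inner product, as a linear map in its second argument. -/
def innerForm [Fintype ι] : HTensor H →ₗ[ℂ] (HTensor H →ₗ⋆[ℂ] ℂ) :=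
  PiTensorProduct.lift
    { toFun := innerLeft
      map_update_add' := fun y i a b => antilinear_ext fun x => by
        simp only [LinearMap.add_apply, innerLeft_tprod, MultilinearMap.map_update_add]
      map_update_smul' := fun y i c a => antilinear_ext fun x => by
        simp only [LinearMap.smul_apply, innerLeft_tprod, MultilinearMap.map_update_smul] }

theorem innerForm_tprod [Fintype ι] (x y : ∀ i, H i) :
    innerForm (tprod y) (tprod x) = ∏ i, ⟪x i, y i⟫_ℂ := by
  rw [← innerPure_apply, ← innerLeft_tprod]
  exact congrArg (fun f : HTensor H →ₗ⋆[ℂ] ℂ => f (tprod x)) (PiTensorProduct.lift.tprod y)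

theorem innerForm_conj [Fintype ι] (x y : HTensor H) :
    starRingEnd ℂ (innerForm x y) = innerForm y x := by
  induction x using HTensor.induction with
  | hs c x =>
    induction y using HTensor.induction with
    | hs d y => simp [innerForm_tprod]; ring
    | ha y z hy hz => rw [map_add, map_add, map_add, hy, hz, LinearMap.add_apply]
  | ha x z hx hz => simp_all

theorem innerForm_map [Fintype ι] (f : ∀ i, H i →ₗᵢ[ℂ] K i) (x y : HTensor H) :
    innerForm (map (fun i => (f i).toLinearMap) x) (map (fun i => (f i).toLinearMap) y) =
      innerForm x y := by
  induction x using HTensor.induction with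
  | hs c x =>
    induction y using HTensor.induction with
    | hs d y => simp [innerForm_tprod, map_tprod]
    | ha y z hy hz => rw [map_add, map_add, map_add, hy, hz]
  | ha x z hx hz => simp_all

/-- Every tensor comes from finite-dimensional subspaces of the factors. -/
theorem exists_finite (x : HTensor H) : ∃ W : ∀ i, Submodule ℂ (H i),
    (∀ i, FiniteDimensional ℂ (W i)) ∧
      ∃ y : HTensor (fun i => W i), map (fun i => (W i).subtype) y = x := by
  induction x using HTensor.induction with
  | hs c x =>
    refine ⟨fun i => Submodule.span ℂ {x i}, fun i => inferInstance,
      c • tprod fun i => ⟨x i, Submodule.mem_span_singleton_self _⟩, ?_⟩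
    simp [map_tprod]
  | ha x y hx hy =>
    obtain ⟨W, hW, a, rfl⟩ := hx
    obtain ⟨Z, hZ, b, rfl⟩ := hy
    refine ⟨fun i => W i ⊔ Z i, fun i => inferInstance,
      map (fun i => Submodule.inclusion le_sup_left) a +
        map (fun i => Submodule.inclusion le_sup_right) b, ?_⟩
    rw [map_add, map_map, map_map]
    rfl

theorem innerForm_self [Fintype ι] [DecidableEq ι] {κ : ι → Type*} [∀ i, Fintype (κ i)]
    (b : ∀ i, OrthonormalBasis (κ i) ℂ (H i)) (x : HTensor H) :
    innerForm x x =
      ((∑ p, ‖(Basis.piTensorProduct fun i => (b i).toBasis).repr x p‖ ^ 2 : ℝ) : ℂ) := by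
  set B : Module.Basis (∀ i, κ i) ℂ (HTensor H) :=
    Basis.piTensorProduct fun i => (b i).toBasis with hB
  have hBt : ∀ p, B p = tprod fun i => b i (p i) := fun p => by
    rw [hB]
    refine (Basis.piTensorProduct_apply _ p).trans ?_
    simp only [OrthonormalBasis.coe_toBasis]
    rfl
  classical
  have ho : ∀ p q, innerForm (B p) (B q) = if q = p then 1 else 0 := fun p q => by
    rw [hBt, hBt, innerForm_tprod]
    simp only [OrthonormalBasis.inner_eq_ite]
    rw [Finset.prod_ite_zero]
    simp [funext_iff]
  change innerForm x x = ((∑ p, ‖B.repr x p‖ ^ 2 : ℝ) : ℂ)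
  have hx := B.sum_repr x
  conv_lhs => rw [← hx]
  simp only [map_sum, LinearMap.sum_apply, map_smul, LinearMap.smul_apply, LinearMap.map_smulₛₗ,
    ho, smul_eq_mul]
  simp [Complex.mul_conj, Complex.normSq_eq_norm_sq, mul_comm]

theorem innerForm_pos [Fintype ι] (x : HTensor H) :
    0 ≤ (innerForm x x).re ∧ (innerForm x x = 0 → x = 0) := by
  classical
  obtain ⟨W, hW, y, rfl⟩ := exists_finite x
  have h := innerForm_map (fun i => (W i).subtypeₗᵢ) y y
  change innerForm (map (fun i => (W i).subtype) y) (map (fun i => (W i).subtype) y) = _ at h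
  rw [h, innerForm_self (fun i => stdOrthonormalBasis ℂ (W i))]
  refine ⟨?_, fun h0 => ?_⟩
  · rw [Complex.ofReal_re]
    positivity
  · rw [Complex.ofReal_eq_zero, Finset.sum_eq_zero_iff_of_nonneg fun _ _ => by positivity] at h0
    have : y = 0 := by
      let B : Module.Basis _ ℂ (HTensor fun i => W i) :=
        Basis.piTensorProduct fun i => (stdOrthonormalBasis ℂ (W i)).toBasis
      refine B.ext_elem fun p => ?_
      have := h0 p (Finset.mem_univ p)
      rw [sq_eq_zero_iff, norm_eq_zero] at this
      rw [map_zero]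
      exact this
    rw [this, map_zero]

/-- The inner product of the tensor product. -/
@[reducible] def core [Fintype ι] : InnerProductSpace.Core ℂ (HTensor H) where
  inner x y := innerForm y x
  conj_inner_symm x y := innerForm_conj x y
  re_inner_nonneg x := (innerForm_pos x).1
  add_left x y z := map_add (innerForm z) x y
  smul_left x y c := (innerForm y).map_smulₛₗ c x
  definite x := (innerForm_pos x).2

instance [Finite ι] : NormedAddCommGroup (HTensor H) :=
  letI := Fintype.ofFinite ι
  core.toNormedAddCommGroup

instance [Finite ι] : InnerProductSpace ℂ (HTensor H) :=
  letI := Fintype.ofFinite ι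
  InnerProductSpace.ofCore core.toCore

theorem inner_tprod [Fintype ι] (x y : ∀ i, H i) :
    ⟪tprod x, tprod y⟫_ℂ = ∏ i, ⟪x i, y i⟫_ℂ := by
  refine (@innerForm_tprod _ _ _ _ (Fintype.ofFinite ι) x y).trans ?_
  exact Finset.prod_congr (by ext; simp) fun _ _ => rfl

end HTensor

/-! ### Unitary representations -/

section Representations

universe u w

/-- The dual of a Hilbert space is a Hilbert space, through the Riesz isomorphism. -/
instance dualInnerProductSpace (H : Type*) [NormedAddCommGroup H] [InnerProductSpace ℂ H]
    [CompleteSpace H] : InnerProductSpace ℂ (StrongDual ℂ H) where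
  inner f g := ⟪(InnerProductSpace.toDual ℂ H).symm g, (InnerProductSpace.toDual ℂ H).symm f⟫_ℂ
  norm_sq_eq_re_inner f := by
    rw [inner_self_eq_norm_sq, LinearIsometryEquiv.norm_map]
  conj_inner_symm f g := inner_conj_symm _ _
  add_left f g h := by rw [map_add, inner_add_right]
  smul_left f g c := by rw [LinearIsometryEquiv.map_smulₛₗ, inner_smul_right]

/-- A (strongly continuous) unitary representation of `G` on a complex Hilbert space. -/
structure UnitaryRep (G : Type*) [Group G] [TopologicalSpace G] where
  space : Type u
  [normed : NormedAddCommGroup space]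
  [inner : InnerProductSpace ℂ space]
  [complete : CompleteSpace space]
  op : G →* (space ≃ₗᵢ[ℂ] space)
  continuous_op : ∀ x, Continuous fun g => op g x

attribute [instance] UnitaryRep.normed UnitaryRep.inner UnitaryRep.complete

variable {G : Type*} [Group G] [TopologicalSpace G]

namespace UnitaryRep

/-- No closed invariant subspaces other than `0` and the whole, nonzero, space. -/
def IsIrreducible (π : UnitaryRep.{u} G) : Prop :=
  Nontrivial π.space ∧ ∀ W : Submodule ℂ π.space, IsClosed (W : Set π.space) →
    (∀ g, ∀ x ∈ W, π.op g x ∈ W) → W = ⊥ ∨ W = ⊤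

/-- Unitary equivalences of unitary representations. -/
structure Equivalence (π σ : UnitaryRep.{u} G) extends π.space ≃ₗᵢ[ℂ] σ.space where
  intertwines : ∀ g x, toFun (π.op g x) = σ.op g (toFun x)

theorem op_inv_op (π : UnitaryRep.{u} G) (g : G) (x : π.space) : π.op g⁻¹ (π.op g x) = x := by
  change (π.op g⁻¹ * π.op g) x = x
  rw [← map_mul, inv_mul_cancel, map_one]
  rfl

theorem op_op_inv (π : UnitaryRep.{u} G) (g : G) (x : π.space) : π.op g (π.op g⁻¹ x) = x := by
  change (π.op g * π.op g⁻¹) x = x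
  rw [← map_mul, mul_inv_cancel, map_one]
  rfl

/-- The operator `f ↦ f ∘ π(g)⁻¹` on the dual space. -/
def dualOp (π : UnitaryRep.{u} G) (g : G) :
    StrongDual ℂ π.space ≃ₗᵢ[ℂ] StrongDual ℂ π.space where
  toFun f := f ∘L ((π.op g⁻¹).toContinuousLinearEquiv : π.space →L[ℂ] π.space)
  invFun f := f ∘L ((π.op g).toContinuousLinearEquiv : π.space →L[ℂ] π.space)
  map_add' _ _ := rfl
  map_smul' _ _ := rfl
  left_inv f := by
    ext x
    change f (π.op g⁻¹ (π.op g x)) = f x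
    rw [π.op_inv_op]
  right_inv f := by
    ext x
    change f (π.op g (π.op g⁻¹ x)) = f x
    rw [π.op_op_inv]
  norm_map' f := f.opNorm_comp_linearIsometryEquiv (π.op g⁻¹)

theorem dualOp_apply (π : UnitaryRep.{u} G) (g : G) (f : StrongDual ℂ π.space) (x : π.space) :
    π.dualOp g f x = f (π.op g⁻¹ x) := rfl

theorem dualOp_toDual (π : UnitaryRep.{u} G) (g : G) (x : π.space) :
    π.dualOp g (InnerProductSpace.toDual ℂ π.space x) =
      InnerProductSpace.toDual ℂ π.space (π.op g x) := by
  ext y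
  rw [dualOp_apply, InnerProductSpace.toDual_apply_apply, InnerProductSpace.toDual_apply_apply,
    ← (π.op g).inner_map_map x, op_op_inv]

/-- The dual representation. -/
def dual (π : UnitaryRep.{u} G) : UnitaryRep.{u} G where
  space := StrongDual ℂ π.space
  op :=
    { toFun := π.dualOp
      map_one' := by ext f x; simp [dualOp_apply]
      map_mul' := fun g h => by ext f x; simp [dualOp_apply] }
  continuous_op f := by
    obtain ⟨x, rfl⟩ := (InnerProductSpace.toDual ℂ π.space).surjective f
    simp only [MonoidHom.coe_mk, OneHom.coe_mk, dualOp_toDual]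
    exact (InnerProductSpace.toDual ℂ π.space).continuous.comp (π.continuous_op x)

theorem IsIrreducible.dual {π : UnitaryRep.{u} G} (h : π.IsIrreducible) :
    π.dual.IsIrreducible := by
  obtain ⟨hn, h⟩ := h
  let R := InnerProductSpace.toDual ℂ π.space
  refine ⟨R.toEquiv.symm.nontrivial, fun W hW hinv => ?_⟩
  rcases h (W.comap (R.toLinearEquiv : π.space →ₗ⋆[ℂ] StrongDual ℂ π.space))
    (hW.preimage R.continuous) (fun g x hx => by
      have := hinv g _ hx
      change R (π.op g x) ∈ W
      rw [← dualOp_toDual]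
      exact this) with h0 | h0
  · left
    refine (Submodule.eq_bot_iff _).2 fun f hf => ?_
    obtain ⟨x, rfl⟩ := R.surjective f
    have : x ∈ W.comap (R.toLinearEquiv : π.space →ₗ⋆[ℂ] StrongDual ℂ π.space) := hf
    rw [h0, Submodule.mem_bot] at this
    rw [this, map_zero]
    rfl
  · right
    refine (Submodule.eq_top_iff').2 fun f => ?_
    obtain ⟨x, rfl⟩ := R.surjective f
    have : x ∈ W.comap (R.toLinearEquiv : π.space →ₗ⋆[ℂ] StrongDual ℂ π.space) := by
      rw [h0]; trivial
    exact this

end UnitaryRep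

variable (G) in
/-- A set of irreducible unitary representations of `G`, one for each equivalence class. -/
structure IrrepSet where
  Label : Type w
  rep : Label → UnitaryRep.{u} G
  irreducible : ∀ l, (rep l).IsIrreducible
  existsUnique : ∀ π : UnitaryRep.{u} G, π.IsIrreducible → ∃! l, Nonempty (π.Equivalence (rep l))

namespace IrrepSet

variable (Λ : IrrepSet.{u, w} G)

/-- The Hilbert space of the representation with label `l`. -/
abbrev space (l : Λ.Label) : Type u := (Λ.rep l).space

/-- The label `l*` of the representation of `Λ` that is equivalent to the dual of `l`. -/
def dual (l : Λ.Label) : Λ.Label := (Λ.existsUnique _ (Λ.irreducible l).dual).choose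

theorem nonempty_dualEquivalence (l : Λ.Label) :
    Nonempty ((Λ.rep (Λ.dual l)).Equivalence (Λ.rep l).dual) := by
  obtain ⟨J⟩ := (Λ.existsUnique _ (Λ.irreducible l).dual).choose_spec.1
  refine ⟨J.toLinearIsometryEquiv.symm, fun g x => ?_⟩
  refine J.toLinearIsometryEquiv.injective ?_
  refine (J.toLinearIsometryEquiv.apply_symm_apply _).trans (Eq.trans ?_ (J.intertwines g _).symm)
  exact congrArg _ (J.toLinearIsometryEquiv.apply_symm_apply x).symm

end IrrepSet

end Representations

/-! ### Graphs, connections and gauge transformations -/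

/-- A directed graph with vertex set `V` and edge set `E`. -/
structure DiGraph (V E : Type*) where
  source : E → V
  target : E → V

namespace DiGraph

variable {V E : Type*} (φ : DiGraph V E)

/-- The edges with source `v`. -/
abbrev S (v : V) : Type _ := {e : E // φ.source e = v}

/-- The edges with target `v`. -/
abbrev T (v : V) : Type _ := {e : E // φ.target e = v}

end DiGraph

section Bundles

universe w

variable (𝔤 : Type*) [NormedAddCommGroup 𝔤] [NormedSpace ℝ 𝔤]
  (G : Type*) [Group G] [TopologicalSpace G] [ChartedSpace 𝔤 G]

/-- A smooth principal `G`-bundle over the discrete space `V`, given by its fibers: smooth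
manifolds with a right action of `G` (an action of `Gᵐᵒᵖ`). Over a discrete base, local triviality
says that each fiber is equivariantly diffeomorphic to `G`. -/
structure PrincipalBundle (V : Type*) where
  fiber : V → Type w
  [top : ∀ v, TopologicalSpace (fiber v)]
  [charted : ∀ v, ChartedSpace 𝔤 (fiber v)]
  [manifold : ∀ v, IsManifold 𝓘(ℝ, 𝔤) ∞ (fiber v)]
  [act : ∀ v, MulAction Gᵐᵒᵖ (fiber v)]
  locally_trivial : ∀ v, ∃ Φ : fiber v ≃ₘ^∞⟮𝓘(ℝ, 𝔤), 𝓘(ℝ, 𝔤)⟯ G,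
    ∀ x g, Φ (MulOpposite.op g • x) = Φ x * g

attribute [instance] PrincipalBundle.top PrincipalBundle.charted PrincipalBundle.manifold
  PrincipalBundle.act

variable {𝔤 G} {V E : Type*}

namespace PrincipalBundle

variable (P : PrincipalBundle 𝔤 G V)

/-- A trivialization of `P`. -/
structure Trivialization where
  chart : ∀ v, P.fiber v ≃ₘ^∞⟮𝓘(ℝ, 𝔤), 𝓘(ℝ, 𝔤)⟯ G
  equivariant : ∀ v x g, chart v (MulOpposite.op g • x) = chart v x * g

theorem nonempty_trivialization : Nonempty P.Trivialization := by
  choose Φ hΦ using P.locally_trivial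
  exact ⟨⟨Φ, hΦ⟩⟩

/-- The smooth maps `P_v → P_w` that are compatible with the right action of `G`. -/
def EquivariantMap (v w : V) : Type _ :=
  {F : P.fiber v → P.fiber w // ContMDiff 𝓘(ℝ, 𝔤) 𝓘(ℝ, 𝔤) ∞ F ∧
    ∀ x (g : G), F (MulOpposite.op g • x) = MulOpposite.op g • F x}

/-- The topology of pointwise convergence. (Evaluation at any point of `P_v` is then a
homeomorphism to `P_w`.) -/
instance (v w : V) : TopologicalSpace (P.EquivariantMap v w) :=
  TopologicalSpace.induced (fun F => F.1) inferInstance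

/-- The Borel sets. -/
instance (v w : V) : MeasurableSpace (P.EquivariantMap v w) := borel _

/-- The gauge group of the fiber `P_v`: its equivariant self-diffeomorphisms, which are the
elements of `P_v ×_Ad G` regarded as maps `P_v → P_v`. -/
def fiberGauge (v : V) : Subgroup (Equiv.Perm (P.fiber v)) where
  carrier := {f | ContMDiff 𝓘(ℝ, 𝔤) 𝓘(ℝ, 𝔤) ∞ f ∧ ContMDiff 𝓘(ℝ, 𝔤) 𝓘(ℝ, 𝔤) ∞ f.symm ∧
    ∀ x (g : G), f (MulOpposite.op g • x) = MulOpposite.op g • f x}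
  one_mem' := ⟨contMDiff_id, contMDiff_id, fun _ _ => rfl⟩
  mul_mem' := fun {f h} hf hh => ⟨hf.1.comp hh.1, hh.2.1.comp hf.2.1, fun x g => by
    rw [Equiv.Perm.mul_apply, hh.2.2, hf.2.2]; rfl⟩
  inv_mem' := fun {f} hf => ⟨hf.2.1, hf.1, fun x g => by
    rw [Equiv.Perm.inv_eq_iff_eq, hf.2.2]; simp⟩

/-- The group `𝒢` of gauge transformations. -/
def Gauge : Type _ := ∀ v, P.fiberGauge v

instance : Group P.Gauge := inferInstanceAs (Group (∀ v, P.fiberGauge v))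

variable (φ : DiGraph V E)

/-- The space `𝒜` of connections on the graph `φ`. -/
def Connection : Type _ := ∀ e, P.EquivariantMap (φ.source e) (φ.target e)

instance : MeasurableSpace (P.Connection φ) :=
  inferInstanceAs (MeasurableSpace (∀ e, P.EquivariantMap (φ.source e) (φ.target e)))

/-- The action of `𝒢` on `𝒜`: `(gA)_e = g_{t(e)} A_e g_{s(e)}⁻¹`. -/
instance : MulAction P.Gauge (P.Connection φ) where
  smul g A := fun e =>
    ⟨fun x => (g (φ.target e)).1 ((A e).1 ((g (φ.source e)).1.symm x)),
      (g (φ.target e)).2.1.comp ((A e).2.1.comp (g (φ.source e)).2.2.1), fun x a => by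
        have h := ((P.fiberGauge (φ.source e)).inv_mem (g (φ.source e)).2).2.2 x a
        change (g (φ.source e)).1.symm _ = _ • (g (φ.source e)).1.symm x at h
        change (g (φ.target e)).1 ((A e).1 ((g (φ.source e)).1.symm _)) = _
        rw [h, (A e).2.2]
        exact (g (φ.target e)).2.2.2 _ a⟩
  one_smul _ := rfl
  mul_smul _ _ _ := rfl

/-- The space `𝒜/𝒢`, with the σ-algebra pushed forward from `𝒜`. -/
abbrev ConnectionModGauge : Type _ :=
  Quotient (MulAction.orbitRel P.Gauge (P.Connection φ))

/-- The class of a connection in `𝒜/𝒢`. -/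
def toModGauge (A : P.Connection φ) : P.ConnectionModGauge φ := Quotient.mk _ A

namespace Trivialization

variable {P} (τ : P.Trivialization)

/-- The group element `a` such that, in the trivialization `τ`, the equivariant map `F` is left
multiplication by `a`. -/
def toGroup {v w : V} (F : P.EquivariantMap v w) : G := τ.chart w (F.1 ((τ.chart v).symm 1))

theorem toGroup_mul {v w : V} (F : P.EquivariantMap v w) (x : P.fiber v) :
    τ.chart w (F.1 x) = τ.toGroup F * τ.chart v x := by
  rw [toGroup, ← τ.equivariant, ← F.2.2]
  have h : MulOpposite.op (τ.chart v x) • (τ.chart v).symm 1 = x := by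
    refine (τ.chart v).injective ?_
    change τ.chart v _ = τ.chart v x
    rw [τ.equivariant]
    simp
  rw [h]

variable [LieGroup 𝓘(ℝ, 𝔤) ∞ G]

/-- The equivariant map that is left multiplication by `a` in the trivialization `τ`. -/
def ofGroup (v w : V) (a : G) : P.EquivariantMap v w :=
  ⟨fun x => (τ.chart w).symm (a * τ.chart v x),
    (τ.chart w).symm.contMDiff.comp (contMDiff_mul_left.comp (τ.chart v).contMDiff),
    fun x g => by
      refine (τ.chart w).injective ?_
      change τ.chart w ((τ.chart w).symm (a * τ.chart v (MulOpposite.op g • x))) =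
        τ.chart w (MulOpposite.op g • (τ.chart w).symm (a * τ.chart v x))
      rw [τ.equivariant, τ.equivariant]
      simp [mul_assoc]⟩

theorem toGroup_ofGroup (v w : V) (a : G) : τ.toGroup (τ.ofGroup v w a) = a := by
  simp [toGroup, ofGroup]

/-- The identification of `G^E` with `𝒜` by the trivialization `τ`. -/
def connection (a : E → G) : P.Connection φ := fun e => τ.ofGroup _ _ (a e)

/-- The product of the normalized Haar measures, carried from `G^E` to `𝒜` by `τ`. -/
def measure [Fintype E] [IsTopologicalGroup G] [CompactSpace G] [MeasurableSpace G]
    [BorelSpace G] : Measure (P.Connection φ) :=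
  (Measure.pi fun _ : E => Measure.haarMeasure (⊤ : TopologicalSpace.PositiveCompacts G)).map
    (τ.connection φ)

end Trivialization

variable [LieGroup 𝓘(ℝ, 𝔤) ∞ G] [Fintype E] [IsTopologicalGroup G] [CompactSpace G]
  [MeasurableSpace G] [BorelSpace G]

/-- The probability measure `μ` on `𝒜`, through any one trivialization. -/
def measure : Measure (P.Connection φ) := P.nonempty_trivialization.some.measure φ

/-- The Hilbert space `L²(𝒜/𝒢)`, for the pushforward of `μ`. -/
abbrev L2ModGauge : Type _ := Lp ℂ 2 ((P.measure φ).map (P.toModGauge φ))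

end PrincipalBundle

end Bundles

/-! ### Spin networks -/

section SpinNetworks

universe u w

variable {G : Type*} [Group G] [TopologicalSpace G] (Λ : IrrepSet.{u, w} G)
  {V E : Type*} [Finite E] (φ : DiGraph V E)

/-- The space `⨂_{e ∈ S(v)} ρ_e ⊗ ⨂_{e ∈ T(v)} ρ_e*`. -/
abbrev VertexSpace (ρ : E → Λ.Label) (v : V) : Type _ :=
  HTensor (fun e : φ.S v => Λ.space (ρ e)) ⊗[ℂ] HTensor (fun e : φ.T v => Λ.space (Λ.dual (ρ e)))

/-- The action of `g ∈ G` on the vertex space. -/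
def vertexOp (ρ : E → Λ.Label) (v : V) (g : G) :
    VertexSpace Λ φ ρ v →ₗ[ℂ] VertexSpace Λ φ ρ v :=
  TensorProduct.map
    (HTensor.map fun e : φ.S v => ((Λ.rep (ρ e)).op g).toLinearEquiv.toLinearMap)
    (HTensor.map fun e : φ.T v => ((Λ.rep (Λ.dual (ρ e))).op g).toLinearEquiv.toLinearMap)

/-- `Inv(v,ρ)`, the subspace of invariant elements of the vertex space. -/
def Inv (ρ : E → Λ.Label) (v : V) : Submodule ℂ (VertexSpace Λ φ ρ v) where
  carrier := {x | ∀ g, vertexOp Λ φ ρ v g x = x}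
  zero_mem' _ := map_zero _
  add_mem' hx hy g := by rw [map_add, hx g, hy g]
  smul_mem' c x hx g := by rw [map_smul, hx g]

variable {𝔤 : Type*} [NormedAddCommGroup 𝔤] [NormedSpace ℝ 𝔤] [ChartedSpace 𝔤 G]
  {P : PrincipalBundle 𝔤 G V}

/-- `L` is the map that sends elements of `⨂_v (⨂_{e ∈ S(v)} ρ_e ⊗ ⨂_{e ∈ T(v)} ρ_e*)` to functions
on `𝒜` by means of the trivialization `τ`: it regroups the tensor factors by edges, and maps
`x ⊗ y ∈ ρ_e ⊗ ρ_e*` to the normalized matrix coefficient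
`A ↦ (dim ρ_e)^{1/2} y(ρ_e(A_e) x)`. Here `J l` identifies the representation `l*` with the dual
of `l`. Since pure tensors span, at most one linear map has this property. -/
def IsMatrixCoefficientMap [Fintype E] (τ : P.Trivialization)
    (J : ∀ l, (Λ.rep (Λ.dual l)).Equivalence (Λ.rep l).dual) (ρ : E → Λ.Label)
    (L : HTensor (VertexSpace Λ φ ρ) →ₗ[ℂ] (P.Connection φ → ℂ)) : Prop :=
  ∀ (x : ∀ e, Λ.space (ρ e)) (y : ∀ e, Λ.space (Λ.dual (ρ e))) (A : P.Connection φ),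
    L (HTensor.tprod fun v =>
        HTensor.tprod (fun e : φ.S v => x e) ⊗ₜ[ℂ] HTensor.tprod (fun e : φ.T v => y e)) A =
      ∏ e, (Real.sqrt (Module.finrank ℂ (Λ.space (ρ e))) : ℂ) *
        (show StrongDual ℂ (Λ.space (ρ e)) from (J (ρ e)).toLinearIsometryEquiv (y e))
          ((Λ.rep (ρ e)).op (τ.toGroup (A e)) (x e))

/-- The summand `⨂_{v ∈ V} Inv(v,ρ)`. -/
abbrev InvTensor (ρ : E → Λ.Label) : Type _ := HTensor fun v => Inv Λ φ ρ v

instance [Finite V] (ρ : E → Λ.Label) : NormedAddCommGroup (InvTensor Λ φ ρ) :=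
  inferInstance

instance [Finite V] (ρ : E → Λ.Label) : InnerProductSpace ℂ (InvTensor Λ φ ρ) :=
  inferInstance

/-- The Hilbert space `⨁_{ρ ∈ Λ^E} ⨂_{v ∈ V} Inv(v,ρ)`. -/
abbrev SpinNetworkSpace [Finite V] : Type _ := lp (InvTensor Λ φ) 2

open Classical in
/-- The vector `⨂_v ι_v` in the summand with label `ρ`. -/
def spinNetwork [Finite V] (ρ : E → Λ.Label) (ι : ∀ v, Inv Λ φ ρ v) : SpinNetworkSpace Λ φ :=
  lp.single 2 ρ (HTensor.tprod ι)

end SpinNetworks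

end SpinNet

end

/-! A trivialization turns `𝒜` into `G^E`, with `k ∈ G^V` acting by `a_e ↦ k_{t(e)} a_e k_{s(e)}⁻¹`
(`gaugeAct`). Passing to another trivialization acts on coordinates in the same way, by the
transition functions (`coords_eq_gaugeAct`). Haar measure on a compact group is left and right
invariant, so `gaugeAct` preserves the product measure. This proves (1), and it makes every
gauge-invariant function on `G^E` a function on `𝒜/𝒢` that does not depend on the trivialization.

The map `coefMap` from tensors to functions on `G^E` intertwines the vertex operators with
`gaugeAct`, so invariant tensors give gauge-invariant functions. By Fubini and Schur orthogonality
edge by edge, with `(dim ρ_e)^{1/2}` as the normalization, `coefMap` is isometric for fixed `ρ`, and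
its images for different `ρ` are orthogonal (`integral_coefMap`, `integral_coefMap_of_ne`).

For completeness (`ae_eq_zero_of_orthogonal`), let `f` be gauge invariant and orthogonal to all
functions that come from invariants. Pairing with `f` is a gauge-invariant functional on tensors,
and such a functional does not see the orthogonal complement of `Inv(v,ρ)` at any vertex. Hence it
vanishes on all tensors, `f` is orthogonal to all products of matrix coefficients, and `f = 0` by
Peter–Weyl for `G^E`.

Peter–Weyl rests on averaging a rank-one operator over the group. The average is a nonzero compact
self-adjoint intertwiner, so it has a finite-dimensional invariant eigenspace. If the complement of
the matrix coefficients in `L²` were nonzero, it would contain a finite-dimensional invariant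
subspace; but the elements of such a subspace are matrix coefficients themselves. The coefficients
of `G^E` are then split into products one factor at a time. -/

noncomputable section

namespace SpinNet

universe u u₁ u₂ w

/-! ### Haar measure on compact groups -/

/-- Haar probability measures on compact groups are right invariant. -/
theorem isMulRightInvariant_of_compactSpace {K : Type*} [Group K] [TopologicalSpace K]
    [IsTopologicalGroup K] [CompactSpace K] [MeasurableSpace K] [BorelSpace K] (μ : Measure K)
    [IsProbabilityMeasure μ] [μ.IsHaarMeasure] : μ.IsMulRightInvariant where
  map_mul_right_eq_self g := by
    have hm : Measurable (· * g : K → K) := (continuous_mul_const g).measurable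
    have : IsProbabilityMeasure (μ.map (· * g)) := Measure.isProbabilityMeasure_map hm.aemeasurable
    have : (μ.map (· * g)).IsHaarMeasure := Measure.isHaarMeasure_map_mul_right μ g
    exact Measure.isHaarMeasure_eq_of_isProbabilityMeasure _ _

theorem integrable_of_continuous {K : Type*} [TopologicalSpace K] [CompactSpace K]
    [MeasurableSpace K] [BorelSpace K] (μ : Measure K) [IsFiniteMeasure μ] {F : Type*}
    [NormedAddCommGroup F] {f : K → F} (hf : Continuous f) : Integrable f μ :=
  hf.integrable_of_hasCompactSupport (HasCompactSupport.of_compactSpace f)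

/-! ### Invariant subspaces, intertwiners and Schur's lemma -/

namespace UnitaryRep

section Algebra

variable {K : Type*} [Group K] [TopologicalSpace K]

theorem op_one_apply (π : UnitaryRep.{u} K) (x : π.space) : π.op 1 x = x := by
  rw [map_one]; rfl

theorem op_mul_apply (π : UnitaryRep.{u} K) (g h : K) (x : π.space) :
    π.op (g * h) x = π.op g (π.op h x) := by
  rw [map_mul]; rfl

theorem inner_op_left (π : UnitaryRep.{u} K) (g : K) (x y : π.space) :
    ⟪π.op g x, y⟫_ℂ = ⟪x, π.op g⁻¹ y⟫_ℂ := by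
  rw [← (π.op g).inner_map_map x, op_op_inv]

theorem inner_op_right (π : UnitaryRep.{u} K) (g : K) (x y : π.space) :
    ⟪x, π.op g y⟫_ℂ = ⟪π.op g⁻¹ x, y⟫_ℂ := by
  rw [← (π.op g).inner_map_map (π.op g⁻¹ x), op_op_inv]

/-- A subspace that is mapped into itself by all operators of the representation. -/
def IsInvariant (π : UnitaryRep.{u} K) (W : Submodule ℂ π.space) : Prop :=
  ∀ g, ∀ x ∈ W, π.op g x ∈ W

theorem IsInvariant.orthogonal {π : UnitaryRep.{u} K} {W : Submodule ℂ π.space}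
    (h : π.IsInvariant W) : π.IsInvariant Wᗮ := fun g x hx => by
  rw [Submodule.mem_orthogonal] at hx ⊢
  intro y hy
  rw [inner_op_right]
  exact hx _ (h _ _ hy)

theorem IsInvariant.inf {π : UnitaryRep.{u} K} {W W' : Submodule ℂ π.space}
    (h : π.IsInvariant W) (h' : π.IsInvariant W') : π.IsInvariant (W ⊓ W') :=
  fun g x hx => ⟨h g x hx.1, h' g x hx.2⟩

/-- The restriction of a representation to a complete invariant subspace. -/
abbrev restrict (π : UnitaryRep.{u} K) (W : Submodule ℂ π.space) [CompleteSpace W]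
    (h : π.IsInvariant W) : UnitaryRep.{u} K where
  space := W
  op :=
    { toFun := fun g =>
        { toFun := fun x => ⟨π.op g x, h g x x.2⟩
          invFun := fun x => ⟨π.op g⁻¹ x, h g⁻¹ x x.2⟩
          map_add' := fun x y => Subtype.ext (map_add (π.op g) _ _)
          map_smul' := fun c x => Subtype.ext (map_smul (π.op g) c _)
          left_inv := fun x => Subtype.ext (π.op_inv_op g x)
          right_inv := fun x => Subtype.ext (π.op_op_inv g x)
          norm_map' := fun x => (π.op g).norm_map x }
      map_one' := by ext x; exact π.op_one_apply x
      map_mul' := fun g h => by ext x; exact π.op_mul_apply g h x }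
  continuous_op x := (π.continuous_op x).subtype_mk _

/-- The representation carried to another Hilbert space by a linear isometry. -/
def transport (π : UnitaryRep.{u₁} K) {H : Type u₂} [NormedAddCommGroup H]
    [InnerProductSpace ℂ H] [CompleteSpace H] (e : π.space ≃ₗᵢ[ℂ] H) : UnitaryRep.{u₂} K where
  space := H
  op :=
    { toFun := fun g => (e.symm.trans (π.op g)).trans e
      map_one' := by ext x; simp
      map_mul' := fun g h => by ext x; simp }
  continuous_op x := e.continuous.comp (π.continuous_op _)

theorem transport_op (π : UnitaryRep.{u₁} K) {H : Type u₂} [NormedAddCommGroup H]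
    [InnerProductSpace ℂ H] [CompleteSpace H] (e : π.space ≃ₗᵢ[ℂ] H) (g : K) (x : π.space) :
    (π.transport e).op g (e x) = e (π.op g x) := by
  change e (π.op g (e.symm (e x))) = _
  rw [e.symm_apply_apply]

theorem IsIrreducible.transport {π : UnitaryRep.{u₁} K} (hπ : π.IsIrreducible) {H : Type u₂}
    [NormedAddCommGroup H] [InnerProductSpace ℂ H] [CompleteSpace H] (e : π.space ≃ₗᵢ[ℂ] H) :
    (π.transport e).IsIrreducible := by
  obtain ⟨hn, hi⟩ := hπ
  refine ⟨e.symm.toEquiv.nontrivial, fun W hW h => ?_⟩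
  rcases hi (W.comap e.toLinearEquiv.toLinearMap) (hW.preimage e.continuous) (fun g x hx => by
    have := h g _ hx
    change e (π.op g x) ∈ W
    rw [← transport_op]
    exact this) with h0 | h0
  · left
    refine (Submodule.eq_bot_iff _).2 fun y hy => ?_
    obtain ⟨x, rfl⟩ := e.surjective y
    have : x ∈ W.comap e.toLinearEquiv.toLinearMap := hy
    rw [h0, Submodule.mem_bot] at this
    rw [this, map_zero]
    rfl
  · right
    refine (Submodule.eq_top_iff').2 fun y => ?_
    obtain ⟨x, rfl⟩ := e.surjective y
    have : x ∈ W.comap e.toLinearEquiv.toLinearMap := by rw [h0]; trivial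
    exact this

/-- Pulling a representation back along a continuous homomorphism. -/
def comap {G : Type*} [Group G] [TopologicalSpace G] (π : UnitaryRep.{u} K) (f : G →* K)
    (hf : Continuous f) : UnitaryRep.{u} G where
  space := π.space
  op := π.op.comp f
  continuous_op x := (π.continuous_op x).comp hf

/-- Intertwining operators of unitary representations. -/
def Intertwines (π : UnitaryRep.{u₁} K) (σ : UnitaryRep.{u₂} K) (T : π.space →L[ℂ] σ.space) :
    Prop :=
  ∀ g x, T (π.op g x) = σ.op g (T x)

theorem Intertwines.adjoint {π : UnitaryRep.{u₁} K} {σ : UnitaryRep.{u₂} K}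
    {T : π.space →L[ℂ] σ.space} (h : π.Intertwines σ T) :
    σ.Intertwines π (ContinuousLinearMap.adjoint T) := fun g x => by
  refine ext_inner_right ℂ fun y => ?_
  rw [ContinuousLinearMap.adjoint_inner_left, inner_op_left, inner_op_left,
    ContinuousLinearMap.adjoint_inner_left, h]

theorem Intertwines.isInvariant_eigenspace {π : UnitaryRep.{u} K} {T : π.space →L[ℂ] π.space}
    (h : π.Intertwines π T) (c : ℂ) :
    π.IsInvariant (Module.End.eigenspace (T : Module.End ℂ π.space) c) := fun g x hx => by
  rw [Module.End.mem_eigenspace_iff] at hx ⊢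
  change T _ = _ at hx ⊢
  rw [h, hx, map_smul]

/-- **Schur's lemma** for the self-intertwiners of a finite-dimensional representation. -/
theorem Intertwines.exists_eq_smul {π : UnitaryRep.{u} K} (hπ : π.IsIrreducible)
    [FiniteDimensional ℂ π.space] {T : π.space →L[ℂ] π.space} (h : π.Intertwines π T) :
    ∃ c : ℂ, ∀ x, T x = c • x := by
  have := hπ.1
  obtain ⟨c, hc⟩ := Module.End.exists_eigenvalue (T : Module.End ℂ π.space)
  refine ⟨c, fun x => ?_⟩
  rcases hπ.2 _ (Submodule.closed_of_finiteDimensional _) (h.isInvariant_eigenspace c) with h0 | h0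
  · exact absurd h0 hc
  · have : x ∈ Module.End.eigenspace (T : Module.End ℂ π.space) c := by rw [h0]; trivial
    exact Module.End.mem_eigenspace_iff.1 this

/-- **Schur's lemma**: a nonzero intertwiner of irreducible representations is a multiple of a
unitary equivalence. -/
theorem Intertwines.nonempty_equivalence {π σ : UnitaryRep.{u} K} (hπ : π.IsIrreducible)
    (hσ : σ.IsIrreducible) [FiniteDimensional ℂ π.space]
    {T : π.space →L[ℂ] σ.space} (h : π.Intertwines σ T) (h0 : T ≠ 0) :
    Nonempty (π.Equivalence σ) := by
  -- `T*T` is an intertwiner of `π` with itself, hence a scalar `c`, and `‖Tx‖² = c‖x‖²`. So `T` is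
  -- `√c` times an isometry. Its range is finite-dimensional, therefore closed, and irreducibility
  -- of `σ` makes it everything.
  obtain ⟨c, hc⟩ := Intertwines.exists_eq_smul hπ
    (T := ContinuousLinearMap.adjoint T ∘L T) fun g x => by
      change ContinuousLinearMap.adjoint T (T _) = _
      rw [h, h.adjoint]; rfl
  have hc' : ∀ x, ((‖T x‖ ^ 2 : ℝ) : ℂ) = c * ((‖x‖ ^ 2 : ℝ) : ℂ) := fun x => by
    have : ⟪x, ContinuousLinearMap.adjoint T (T x)⟫_ℂ = c * ⟪x, x⟫_ℂ := by
      rw [← inner_smul_right]; exact congrArg _ (hc x)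
    rw [ContinuousLinearMap.adjoint_inner_right, inner_self_eq_norm_sq_to_K,
      inner_self_eq_norm_sq_to_K] at this
    exact_mod_cast this
  obtain ⟨x₀, hx₀⟩ : ∃ x, T x ≠ 0 := by
    by_contra! hT
    exact h0 (ContinuousLinearMap.ext hT)
  have hx0 : x₀ ≠ 0 := fun hx => hx₀ (by rw [hx, map_zero])
  obtain ⟨r, hr, rfl⟩ : ∃ r : ℝ, 0 < r ∧ ((r ^ 2 : ℝ) : ℂ) = c := by
    refine ⟨‖T x₀‖ / ‖x₀‖, by positivity, ?_⟩
    have hn : (((‖x₀‖ ^ 2 : ℝ)) : ℂ) ≠ 0 := by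
      exact_mod_cast pow_ne_zero 2 (norm_ne_zero_iff.2 hx0)
    rw [div_pow, Complex.ofReal_div, hc', mul_div_cancel_right₀ _ hn]
  have hnorm : ∀ x, ‖T x‖ = r * ‖x‖ := fun x => by
    have := hc' x
    rw [← Complex.ofReal_mul, Complex.ofReal_inj, ← mul_pow] at this
    exact (pow_left_inj₀ (norm_nonneg _) (by positivity) two_ne_zero).1 this
  let F : π.space →ₗᵢ[ℂ] σ.space :=
    { toLinearMap := ((r⁻¹ : ℝ) : ℂ) • (T : π.space →ₗ[ℂ] σ.space)
      norm_map' := fun x => by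
        change ‖((r⁻¹ : ℝ) : ℂ) • T x‖ = _
        rw [norm_smul, hnorm, Complex.norm_real, Real.norm_of_nonneg (by positivity)]
        field_simp }
  have hF : ∀ g x, F (π.op g x) = σ.op g (F x) := fun g x => by
    change ((r⁻¹ : ℝ) : ℂ) • T (π.op g x) = σ.op g (((r⁻¹ : ℝ) : ℂ) • T x)
    rw [h, map_smul]
  have hsurj : Function.Surjective F := by
    rcases hσ.2 (LinearMap.range F.toLinearMap)
      (Submodule.closed_of_finiteDimensional _) (by
        rintro g _ ⟨x, rfl⟩
        exact ⟨π.op g x, hF g x⟩) with h1 | h1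
    · exfalso
      have : F x₀ = 0 := by
        rw [LinearMap.range_eq_bot] at h1
        exact LinearMap.congr_fun h1 x₀
      exact hx0 (F.injective (this.trans (map_zero F).symm))
    · exact LinearMap.range_eq_top.1 h1
  exact ⟨⟨LinearIsometryEquiv.ofSurjective F hsurj, hF⟩⟩

/-- The representations are only strongly continuous, but rank-one operators depend continuously, in
operator norm, on their two vectors. This allows a Bochner integral in the space of operators. -/
theorem continuous_rankOne_op (π : UnitaryRep.{u₁} K) (σ : UnitaryRep.{u₂} K) (x : π.space)
    (x' : σ.space) :
    Continuous fun g => InnerProductSpace.rankOne ℂ (σ.op g x') (π.op g x) :=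
  isBoundedBilinearMap_smulRight.continuous.comp
    (((innerSL ℂ).continuous.comp (π.continuous_op x)).prodMk (σ.continuous_op x'))

end Algebra

/-! ### Averaged rank-one operators -/

section Averaging

variable {K : Type*} [Group K] [TopologicalSpace K] [CompactSpace K] [MeasurableSpace K]
  [BorelSpace K] (μ : Measure K) [IsProbabilityMeasure μ]

/-- The average `∫ σ(g) |x'⟩⟨x| π(g)⁻¹ dg`. -/
def avgOp (π : UnitaryRep.{u₁} K) (σ : UnitaryRep.{u₂} K) (x : π.space) (x' : σ.space) :
    π.space →L[ℂ] σ.space :=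
  ∫ g, InnerProductSpace.rankOne ℂ (σ.op g x') (π.op g x) ∂μ

theorem avgOp_apply (π : UnitaryRep.{u₁} K) (σ : UnitaryRep.{u₂} K) (x : π.space) (x' : σ.space)
    (y : π.space) : avgOp μ π σ x x' y = ∫ g, ⟪π.op g x, y⟫_ℂ • σ.op g x' ∂μ := by
  rw [avgOp, ContinuousLinearMap.integral_apply
    (integrable_of_continuous μ (continuous_rankOne_op π σ x x'))]
  rfl

/-- The matrix elements of the average are the integrals in the orthogonality relations; whatever
Schur's lemma says about the operator becomes a statement about them. -/
theorem inner_avgOp (π : UnitaryRep.{u₁} K) (σ : UnitaryRep.{u₂} K) (x : π.space) (x' : σ.space)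
    (y : π.space) (y' : σ.space) :
    ⟪y', avgOp μ π σ x x' y⟫_ℂ = ∫ g, ⟪π.op g x, y⟫_ℂ * ⟪y', σ.op g x'⟫_ℂ ∂μ := by
  rw [avgOp_apply, ← integral_inner]
  · simp only [inner_smul_right]
  · exact integrable_of_continuous μ
      (((π.continuous_op x).inner continuous_const).smul (σ.continuous_op x'))

/-- An average over a probability measure stays in any closed convex set that contains the
integrand, here the set of compact operators. -/
theorem isCompactOperator_avgOp (π : UnitaryRep.{u₁} K) (σ : UnitaryRep.{u₂} K) (x : π.space)
    (x' : σ.space) : IsCompactOperator (avgOp μ π σ x x') := by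
  have hconv : Convex ℝ {T : π.space →L[ℂ] σ.space | IsCompactOperator T} :=
    ((compactOperator (RingHom.id ℂ) π.space σ.space).restrictScalars ℝ).convex
  refine hconv.integral_mem isClosed_setOfPred_isCompactOperator (Filter.Eventually.of_forall
    fun g => ?_) (integrable_of_continuous μ (continuous_rankOne_op π σ x x'))
  exact (isCompactOperator_of_locallyCompactSpace_rng
    (T := ContinuousLinearMap.toSpanSingleton ℂ (σ.op g x'))).comp_clm (innerSL ℂ (π.op g x))

theorem isSymmetric_avgOp (π : UnitaryRep.{u} K) (x : π.space) :
    (avgOp μ π π x x).IsSymmetric := fun y y' => by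
  change ⟪avgOp μ π π x x y, y'⟫_ℂ = ⟪y, avgOp μ π π x x y'⟫_ℂ
  rw [← inner_conj_symm, inner_avgOp, inner_avgOp, ← integral_conj]
  congr 1
  ext g
  rw [map_mul, inner_conj_symm, inner_conj_symm, mul_comm]

theorem inner_avgOp_self (π : UnitaryRep.{u} K) (x : π.space) :
    ⟪x, avgOp μ π π x x x⟫_ℂ = ((∫ g, ‖⟪π.op g x, x⟫_ℂ‖ ^ 2 ∂μ : ℝ) : ℂ) := by
  rw [inner_avgOp, ← integral_complex_ofReal]
  congr 1
  ext g
  rw [← inner_conj_symm x, Complex.mul_conj, Complex.normSq_eq_norm_sq]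

variable [μ.IsHaarMeasure]

/-- The diagonal matrix element at `x` is the integral of `|⟪π(g)x, x⟫|²`, a continuous nonnegative
function that is positive at `g = 1`, and Haar measure charges open sets. -/
theorem avgOp_ne_zero (π : UnitaryRep.{u} K) {x : π.space} (hx : x ≠ 0) :
    avgOp μ π π x x ≠ 0 := fun h => by
  have h0 := inner_avgOp_self μ π x
  rw [h, zero_apply, inner_zero_right, eq_comm, Complex.ofReal_eq_zero] at h0
  have hc : Continuous fun g => ‖⟪π.op g x, x⟫_ℂ‖ ^ 2 :=
    (((π.continuous_op x).inner continuous_const).norm).pow 2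
  rw [integral_eq_zero_iff_of_nonneg (fun g => by positivity) (integrable_of_continuous μ hc),
    hc.ae_eq_iff_eq μ continuous_zero] at h0
  have h1 := congrFun h0 1
  simp only [op_one_apply, Pi.zero_apply, sq_eq_zero_iff, norm_eq_zero, inner_self_eq_zero] at h1
  exact hx h1

variable [IsTopologicalGroup K]

/-- Left invariance of `μ`: the substitution of `hg` for `g` carries `h` through the average. -/
theorem intertwines_avgOp (π : UnitaryRep.{u₁} K) (σ : UnitaryRep.{u₂} K) (x : π.space)
    (x' : σ.space) : π.Intertwines σ (avgOp μ π σ x x') := fun h y => by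
  refine ext_inner_left ℂ fun y' => ?_
  rw [inner_op_right, inner_avgOp, inner_avgOp, ← integral_mul_left_eq_self _ h]
  congr 1
  ext g
  rw [op_mul_apply, op_mul_apply, (π.op h).inner_map_map, inner_op_right σ h]

end Averaging

/-! ### Irreducible representations are finite-dimensional -/

section FiniteDimensional

variable {K : Type*} [Group K] [TopologicalSpace K] [IsTopologicalGroup K] [CompactSpace K]

/-- Every nonzero unitary representation of a compact group has a nonzero finite-dimensional
invariant subspace. -/
theorem exists_finiteDimensional_isInvariant (π : UnitaryRep.{u} K) [Nontrivial π.space] :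
    ∃ W : Submodule ℂ π.space, W ≠ ⊥ ∧ FiniteDimensional ℂ W ∧ π.IsInvariant W := by
  let : MeasurableSpace K := borel K
  have : BorelSpace K := ⟨rfl⟩
  let μ : Measure K := Measure.haarMeasure ⊤
  have : IsProbabilityMeasure μ := ⟨Measure.haarMeasure_self⟩
  obtain ⟨x, hx⟩ := exists_ne (0 : π.space)
  have hc := isCompactOperator_avgOp μ π π x x
  -- A nonzero compact self-adjoint operator has a nonzero eigenvalue, and compactness makes the
  -- eigenspace finite-dimensional.
  have h := mt (ContinuousLinearMap.eq_zero_of_forall_hasEigenvalue_eq_zero hc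
    (isSymmetric_avgOp μ π x)).1 (avgOp_ne_zero μ π hx)
  push Not at h
  obtain ⟨c, hc1, hc0⟩ := h
  exact ⟨_, hc1, ContinuousLinearMap.finite_dimensional_eigenspace hc c hc0,
    (intertwines_avgOp μ π π x x).isInvariant_eigenspace c⟩

theorem IsIrreducible.finiteDimensional {π : UnitaryRep.{u} K} (hπ : π.IsIrreducible) :
    FiniteDimensional ℂ π.space := by
  have := hπ.1
  obtain ⟨W, hW, hf, hi⟩ := exists_finiteDimensional_isInvariant π
  rcases hπ.2 W (Submodule.closed_of_finiteDimensional _) hi with h | h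
  · exact absurd h hW
  · rw [h] at hf
    exact Module.Finite.equiv (Submodule.topEquiv : (⊤ : Submodule ℂ π.space) ≃ₗ[ℂ] π.space)

end FiniteDimensional

/-! ### Schur orthogonality -/

section Orthogonality

variable {K : Type*} [Group K] [TopologicalSpace K] [IsTopologicalGroup K] [CompactSpace K]
  [MeasurableSpace K] [BorelSpace K] (μ : Measure K)
  [IsProbabilityMeasure μ] [μ.IsHaarMeasure]

/-- Matrix coefficients of inequivalent irreducible representations are orthogonal. -/
theorem integral_coef_of_not_equivalent {π σ : UnitaryRep.{u} K} (hπ : π.IsIrreducible)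
    (hσ : σ.IsIrreducible) (h : ¬ Nonempty (π.Equivalence σ)) (x y : π.space) (x' y' : σ.space) :
    ∫ g, ⟪π.op g x, y⟫_ℂ * ⟪y', σ.op g x'⟫_ℂ ∂μ = 0 := by
  have := hπ.finiteDimensional
  rw [← inner_avgOp]
  by_cases h0 : avgOp μ π σ x x' = 0
  · simp [h0]
  · exact absurd ((intertwines_avgOp μ π σ x x').nonempty_equivalence hπ hσ h0) h

/-- **Schur orthogonality** for the matrix coefficients of an irreducible representation. -/
theorem integral_coef {π : UnitaryRep.{u} K} (hπ : π.IsIrreducible) (x y x' y' : π.space) :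
    Module.finrank ℂ π.space * ∫ g, ⟪π.op g x, y⟫_ℂ * ⟪y', π.op g x'⟫_ℂ ∂μ =
      ⟪x, x'⟫_ℂ * ⟪y', y⟫_ℂ := by
  have := hπ.finiteDimensional
  obtain ⟨c, hc⟩ := (intertwines_avgOp μ π π x x').exists_eq_smul hπ
  have hc' : ∀ y y' : π.space,
      ∫ g, ⟪π.op g x, y⟫_ℂ * ⟪y', π.op g x'⟫_ℂ ∂μ = c * ⟪y', y⟫_ℂ := fun y y' => by
    rw [← inner_avgOp, hc, inner_smul_right]
  rw [hc', ← mul_assoc]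
  congr 1
  -- The trace determines `c`: the sum over `y = y' = b i` is `dim · c` on one side and, by Parseval
  -- and unitarity of `π(g)`, `⟪x, x'⟫` on the other.
  let b := stdOrthonormalBasis ℂ π.space
  have hs : ∑ i, ∫ g, ⟪π.op g x, b i⟫_ℂ * ⟪b i, π.op g x'⟫_ℂ ∂μ = ⟪x, x'⟫_ℂ := by
    rw [← integral_finsetSum]
    · simp only [b.sum_inner_mul_inner, LinearIsometryEquiv.inner_map_map, integral_const,
        probReal_univ, one_smul]
    · exact fun i _ => integrable_of_continuous μ
        (((π.continuous_op x).inner continuous_const).mul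
          (continuous_const.inner (π.continuous_op x')))
  rw [← hs]
  simp only [hc', inner_self_eq_norm_sq_to_K, b.orthonormal.1]
  simp

end Orthogonality

end UnitaryRep

/-! ### Matrix coefficients and their reduction to irreducible ones -/

namespace UnitaryRep

section Coefficients

variable {K : Type*} [Group K] [TopologicalSpace K]

/-- The matrix coefficient `g ↦ ⟪y, π(g) x⟫`. -/
def coef (π : UnitaryRep.{u} K) (y x : π.space) : C(K, ℂ) :=
  ⟨fun g => ⟪y, π.op g x⟫_ℂ, continuous_const.inner (π.continuous_op x)⟩

theorem coef_apply (π : UnitaryRep.{u} K) (y x : π.space) (g : K) :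
    π.coef y x g = ⟪y, π.op g x⟫_ℂ := rfl

theorem coef_add (π : UnitaryRep.{u} K) (y x x' : π.space) :
    π.coef y (x + x') = π.coef y x + π.coef y x' := by
  ext g
  simp [coef_apply]

theorem coef_zero (π : UnitaryRep.{u} K) (y : π.space) : π.coef y 0 = 0 := by
  ext g
  simp [coef_apply]

end Coefficients

section Reducibility

variable {K : Type*} [Group K] [TopologicalSpace K] (Λ : IrrepSet.{u, w} K)

/-- The set of the matrix coefficients of the representations in `Λ`. -/
def _root_.SpinNet.IrrepSet.coefs : Set C(K, ℂ) :=
  {f | ∃ l, ∃ y x : Λ.space l, f = (Λ.rep l).coef y x}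

theorem Equivalence.coef_eq {π σ : UnitaryRep.{u} K} (T : π.Equivalence σ) (y x : π.space) :
    π.coef y x = σ.coef (T.toLinearIsometryEquiv y) (T.toLinearIsometryEquiv x) := by
  ext g
  rw [coef_apply, coef_apply, ← T.toLinearIsometryEquiv.inner_map_map]
  exact congrArg _ (T.intertwines g x)

theorem coef_transport (π : UnitaryRep.{u₁} K) {H : Type u₂} [NormedAddCommGroup H]
    [InnerProductSpace ℂ H] [CompleteSpace H] (e : π.space ≃ₗᵢ[ℂ] H) (y x : π.space) :
    (π.transport e).coef (e y) (e x) = π.coef y x := by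
  ext g
  change ⟪e y, (π.transport e).op g (e x)⟫_ℂ = _
  rw [transport_op, e.inner_map_map]
  rfl

/-- `Λ` classifies only representations in its own universe. Being finite-dimensional, `π` can be
transported there, to a Euclidean space over a lifted index type, with the same coefficients. -/
theorem coef_mem_coefs (π : UnitaryRep.{u₁} K) [FiniteDimensional ℂ π.space]
    (hπ : π.IsIrreducible) (y x : π.space) : π.coef y x ∈ Λ.coefs := by
  let e : π.space ≃ₗᵢ[ℂ] EuclideanSpace ℂ (ULift.{u} (Fin (Module.finrank ℂ π.space))) :=
    ((stdOrthonormalBasis ℂ π.space).reindex Equiv.ulift.symm).repr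
  obtain ⟨l, ⟨T⟩, -⟩ := Λ.existsUnique _ (hπ.transport e)
  refine ⟨l, T.toLinearIsometryEquiv (e y), T.toLinearIsometryEquiv (e x), ?_⟩
  rw [← coef_transport π e]
  exact T.coef_eq (e y) (e x)

theorem coef_restrict (π : UnitaryRep.{u} K) (W : Submodule ℂ π.space) [CompleteSpace W]
    (h : π.IsInvariant W) (y : π.space) (x : W) :
    (π.restrict W h).coef (W.orthogonalProjectionOnto y) x = π.coef y x := by
  ext g
  exact Submodule.inner_orthogonalProjectionOnto_eq_of_mem_right _ _

/-- The matrix coefficients of a finite-dimensional unitary representation are linear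
combinations of those of irreducible ones. -/
theorem coef_mem_span (π : UnitaryRep.{u₁} K) [FiniteDimensional ℂ π.space] (y x : π.space) :
    π.coef y x ∈ Submodule.span ℂ Λ.coefs := by
  -- Induction on the dimension of an invariant `W` that contains `x`, with `y` arbitrary in the
  -- whole space. If `W` is reducible, `x` splits along a proper invariant subspace and its
  -- complement in `W`, both of smaller dimension.
  suffices H : ∀ (n : ℕ) (W : Submodule ℂ π.space), π.IsInvariant W → Module.finrank ℂ W < n →
      ∀ x ∈ W, π.coef y x ∈ Submodule.span ℂ Λ.coefs from
    H _ ⊤ (fun _ _ _ => trivial) (Nat.lt_succ_self _) x trivial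
  intro n
  induction n with
  | zero => exact fun W _ hn => absurd hn (Nat.not_lt_zero _)
  | succ n ih =>
    intro W hW hn x hx
    have : FiniteDimensional ℂ (π.restrict W hW).space := inferInstanceAs (FiniteDimensional ℂ W)
    by_cases hirr : (π.restrict W hW).IsIrreducible
    · rw [← coef_restrict π W hW y ⟨x, hx⟩]
      exact Submodule.subset_span (coef_mem_coefs Λ _ hirr _ _)
    by_cases hx0 : x = 0
    · rw [hx0, coef_zero]
      exact Submodule.zero_mem _
    have hnt : Nontrivial (π.restrict W hW).space :=
      ⟨⟨(⟨x, hx⟩ : W), (0 : W), fun h => hx0 (congrArg Subtype.val h)⟩⟩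
    rw [IsIrreducible, not_and] at hirr
    have h1 := hirr hnt
    push Not at h1
    obtain ⟨W₁, -, hinv, hbot, htop⟩ := h1
    change Submodule ℂ W at W₁
    let W₂ := W₁.map W.subtype
    have hW₂ : π.IsInvariant W₂ := by
      rintro g _ ⟨z, hz, rfl⟩
      exact ⟨_, hinv g z hz, rfl⟩
    have hle : W₂ ≤ W := Submodule.map_subtype_le W W₁
    have hlt : W₂ < W := by
      refine lt_of_le_of_ne hle fun h => htop ?_
      refine (Submodule.eq_top_iff').2 fun z => ?_
      have : (z : π.space) ∈ W₂ := by rw [h]; exact z.2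
      obtain ⟨z', hz', h'⟩ := this
      exact (Subtype.ext h' : z' = z) ▸ hz'
    have hlt' : W₂ᗮ ⊓ W < W := by
      refine lt_of_le_of_ne inf_le_right fun h => hbot ?_
      refine (Submodule.eq_bot_iff _).2 fun z hz => ?_
      have hz1 : (z : π.space) ∈ W₂ᗮ ⊓ W := by rw [h]; exact z.2
      have := Submodule.inner_right_of_mem_orthogonal (⟨z, hz, rfl⟩ : (z : π.space) ∈ W₂) hz1.1
      exact Subtype.ext (inner_self_eq_zero.1 this)
    have hs : x = W₂.starProjection x + (x - W₂.starProjection x) := by abel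
    have hm : W₂.starProjection x ∈ W₂ := W₂.starProjection_apply_mem x
    rw [hs, coef_add]
    refine Submodule.add_mem _ (ih W₂ hW₂ ?_ _ hm) (ih _ (hW₂.orthogonal.inf hW) ?_ _
      ⟨W₂.sub_starProjection_mem_orthogonal x, W.sub_mem hx (hle hm)⟩)
    · exact (Submodule.finrank_lt_finrank_of_lt hlt).trans_le (Nat.lt_succ_iff.1 hn)
    · exact (Submodule.finrank_lt_finrank_of_lt hlt').trans_le (Nat.lt_succ_iff.1 hn)

end Reducibility

/-! ### The regular representation and the Peter–Weyl theorem -/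

section Regular

variable {K : Type u} [Group K] [TopologicalSpace K] [IsTopologicalGroup K] [MeasurableSpace K]
  [BorelSpace K] (μ : Measure K) [μ.IsMulRightInvariant]

/-- The operators of right translation on `L²(K)`. -/
def regularOp : K →* (Lp ℂ 2 μ ≃ₗᵢ[ℂ] Lp ℂ 2 μ) where
  toFun g :=
    { toFun := fun f => DomMulAct.mk (MulOpposite.op g) • f
      invFun := fun f => DomMulAct.mk (MulOpposite.op g⁻¹) • f
      map_add' := fun f f' => smul_add _ f f'
      map_smul' := fun c f => smul_comm _ c f
      left_inv := fun f => inv_smul_smul (DomMulAct.mk (MulOpposite.op g)) f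
      right_inv := fun f => smul_inv_smul (DomMulAct.mk (MulOpposite.op g)) f
      norm_map' := fun f => DomMulAct.norm_smul_Lp _ f }
  map_one' := by
    ext1 f
    exact one_smul Kᵐᵒᵖᵈᵐᵃ f
  map_mul' g h := by
    ext1 f
    exact mul_smul (DomMulAct.mk (MulOpposite.op g)) (DomMulAct.mk (MulOpposite.op h)) f

theorem regular_op_ae_eq (g : K) (f : Lp ℂ 2 μ) : regularOp μ g f =ᵐ[μ] fun x => f (x * g) :=
  DomMulAct.smul_Lp_ae_eq (DomMulAct.mk (MulOpposite.op g)) f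

variable [CompactSpace K] [SecondCountableTopology K] [T2Space K] [IsProbabilityMeasure μ]

/-- The right regular representation on `L²(K)`. -/
abbrev regular : UnitaryRep.{u} K where
  space := Lp ℂ 2 μ
  op := regularOp μ
  continuous_op f :=
    (continuous_const (y := f)).compMeasurePreservingLp
      (ContinuousMap.curry ⟨fun p : K × K => p.2 * p.1, by fun_prop⟩).continuous
      (fun g => measurePreserving_mul_right μ g) ENNReal.ofNat_ne_top

end Regular

end UnitaryRep

namespace UnitaryRep

section PeterWeyl

variable {K : Type u} [Group K] [TopologicalSpace K] [IsTopologicalGroup K] [CompactSpace K]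
  [SecondCountableTopology K] [T2Space K] [MeasurableSpace K] [BorelSpace K] (μ : Measure K)
  [IsProbabilityMeasure μ] [μ.IsHaarMeasure] [μ.IsMulRightInvariant]

/-- The elements of a finite-dimensional invariant subspace of `L²(K)` are matrix coefficients. -/
theorem exists_ae_eq_inner_regular {W : Submodule ℂ (Lp ℂ 2 μ)} [FiniteDimensional ℂ W]
    (hW : (regular μ).IsInvariant W) {f : Lp ℂ 2 μ} (hf : f ∈ W) :
    ∃ y ∈ W, f =ᵐ[μ] (regular μ).coef y f := by
  let R : K → Lp ℂ 2 μ := fun g => (regular μ).op g f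
  let b := stdOrthonormalBasis ℂ W
  have hR : ∀ g, R g = ∑ i, ⟪(b i : Lp ℂ 2 μ), R g⟫_ℂ • (b i : Lp ℂ 2 μ) := fun g => by
    have := congrArg W.subtype (b.sum_repr ⟨R g, hW g f hf⟩)
    rw [map_sum] at this
    refine Eq.trans this.symm ?_
    simp only [map_smul, b.repr_apply_apply]
    rfl
  have hpt : ∀ g, ∀ᵐ x ∂μ, f (x * g) = ∑ i, ⟪(b i : Lp ℂ 2 μ), R g⟫_ℂ * (b i : Lp ℂ 2 μ) x := by
    intro g
    have h1 := regular_op_ae_eq μ g f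
    have h2 : ∀ᵐ x ∂μ, (R g : K → ℂ) x =
        ∑ i, ⟪(b i : Lp ℂ 2 μ), R g⟫_ℂ * (b i : Lp ℂ 2 μ) x := by
      have h3 := Lp.coeFn_finsetSum (p := 2) (μ := μ) Finset.univ
        fun i => ⟪(b i : Lp ℂ 2 μ), R g⟫_ℂ • (b i : Lp ℂ 2 μ)
      have h4 : ∀ᵐ x ∂μ, ∀ i, (⟪(b i : Lp ℂ 2 μ), R g⟫_ℂ • (b i : Lp ℂ 2 μ) : Lp ℂ 2 μ) x =
          ⟪(b i : Lp ℂ 2 μ), R g⟫_ℂ * (b i : Lp ℂ 2 μ) x :=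
        ae_all_iff.2 fun i => Lp.coeFn_smul _ _
      rw [← hR g] at h3
      filter_upwards [h3, h4] with x h3 h4
      rw [h3, Finset.sum_apply]
      exact Finset.sum_congr rfl fun i _ => h4 i
    filter_upwards [h1, h2] with x h1 h2
    rw [← h1, ← h2]
  have hmeas : ∀ h : Lp ℂ 2 μ, Measurable (h : K → ℂ) := fun h =>
    (Lp.stronglyMeasurable h).measurable
  have hRc : ∀ i, Continuous fun g => ⟪(b i : Lp ℂ 2 μ), R g⟫_ℂ := fun i =>
    ((regular μ).coef (b i : Lp ℂ 2 μ) f).continuous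
  have hset : MeasurableSet {p : K × K | f (p.2 * p.1) =
      ∑ i, ⟪(b i : Lp ℂ 2 μ), R p.1⟫_ℂ * (b i : Lp ℂ 2 μ) p.2} := by
    refine measurableSet_eq_fun ((hmeas f).comp (measurable_snd.mul measurable_fst)) ?_
    exact Finset.measurable_sum _ fun i _ =>
      ((hRc i).measurable.comp measurable_fst).mul ((hmeas _).comp measurable_snd)
  -- The expansion holds for each `g` at almost every `x`. Fubini exchanges the quantifiers, so that
  -- one good point `x` can be fixed, with the expansion valid for almost every `g`.
  have hswap := (Measure.ae_ae_comm (μ := μ) (ν := μ) hset).1 (Filter.Eventually.of_forall hpt)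
  obtain ⟨x, hx⟩ := hswap.exists
  -- Pairing with `w` plays the role of evaluation at `x` on `W`, so that `f(xg) = ⟪w, R g⟫` for
  -- almost every `g`. Replacing `g` by `x⁻¹g` moves `x` onto `w`, whence the witness `π(x)w`.
  let w : Lp ℂ 2 μ := ∑ i, (starRingEnd ℂ ((b i : Lp ℂ 2 μ) x)) • (b i : Lp ℂ 2 μ)
  have hw : w ∈ W := W.sum_mem fun i _ => W.smul_mem _ (b i).2
  refine ⟨(regular μ).op x w, hW x w hw, ?_⟩
  have hx' := (eventually_mul_left_iff μ x⁻¹ (p := fun g => f (x * g) =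
      ∑ i, ⟪(b i : Lp ℂ 2 μ), R g⟫_ℂ * (b i : Lp ℂ 2 μ) x)).2 hx
  filter_upwards [hx'] with g hg
  rw [mul_inv_cancel_left] at hg
  rw [hg]
  refine Eq.trans ?_ (((regular μ).inner_op_left x w (R g)).trans
    (congrArg (fun z : Lp ℂ 2 μ => ⟪w, z⟫_ℂ) ((regular μ).op_mul_apply x⁻¹ g f).symm)).symm
  change _ = ⟪∑ i, (starRingEnd ℂ ((b i : Lp ℂ 2 μ) x)) • (b i : Lp ℂ 2 μ), R (x⁻¹ * g)⟫_ℂ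
  rw [sum_inner]
  refine Finset.sum_congr rfl fun i _ => ?_
  rw [inner_smul_left, Complex.conj_conj, mul_comm]

/-- The matrix coefficients of the finite-dimensional unitary representations of `K`. -/
def finiteCoefs (K : Type u) [Group K] [TopologicalSpace K] : Set C(K, ℂ) :=
  {f | ∃ σ : UnitaryRep.{u} K, FiniteDimensional ℂ σ.space ∧ ∃ y x, f = σ.coef y x}

/-- **Peter–Weyl theorem**: a square-integrable function that is orthogonal to all matrix
coefficients of finite-dimensional unitary representations is zero. -/
theorem eq_zero_of_orthogonal_finiteCoefs (f : Lp ℂ 2 μ)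
    (hf : ∀ p ∈ finiteCoefs K, ⟪ContinuousMap.toLp (E := ℂ) 2 μ ℂ p, f⟫_ℂ = 0) : f = 0 := by
  let S : Submodule ℂ (Lp ℂ 2 μ) :=
    (Submodule.span ℂ (finiteCoefs K)).map (ContinuousMap.toLp (E := ℂ) 2 μ ℂ).toLinearMap
  have hS : ∀ h : Lp ℂ 2 μ, h ∈ Sᗮ ↔
      ∀ p ∈ finiteCoefs K, ⟪ContinuousMap.toLp (E := ℂ) 2 μ ℂ p, h⟫_ℂ = 0 := fun h => by
    refine ⟨fun hh p hp => hh _ ⟨p, Submodule.subset_span hp, rfl⟩, fun hh => ?_⟩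
    rintro _ ⟨p, hp, rfl⟩
    induction hp using Submodule.span_induction with
    | mem p hp => exact hh p hp
    | zero => simp
    | add p q _ _ hp hq => rw [map_add, inner_add_left, hp, hq, add_zero]
    | smul c p _ hp => rw [map_smul, inner_smul_left, hp, mul_zero]
  -- A right translate of a matrix coefficient is a coefficient of the same representation, with `x`
  -- replaced by `σ(g⁻¹)x`.
  have hinv : (regular μ).IsInvariant Sᗮ := fun g h hh => by
    rw [hS] at hh
    refine (hS _).2 ?_
    rintro _ ⟨σ, hσ, y, x, rfl⟩
    refine ((regular μ).inner_op_right g _ _).trans ?_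
    refine Eq.trans (congrArg (fun z : Lp ℂ 2 μ => ⟪z, h⟫_ℂ) ?_)
      (hh _ ⟨σ, hσ, y, σ.op g⁻¹ x, rfl⟩)
    refine Lp.ext ?_
    have h1 := regular_op_ae_eq μ g⁻¹ (ContinuousMap.toLp (E := ℂ) 2 μ ℂ (σ.coef y x))
    have h2 := ContinuousMap.coeFn_toLp (p := 2) μ (𝕜 := ℂ) (σ.coef y (σ.op g⁻¹ x))
    have h3 := (measurePreserving_mul_right μ g⁻¹).quasiMeasurePreserving.ae
      (ContinuousMap.coeFn_toLp (p := 2) μ (𝕜 := ℂ) (σ.coef y x))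
    filter_upwards [h1, h2, h3] with z h1 h2 h3
    refine (h1.trans h3).trans (Eq.trans ?_ h2.symm)
    rw [coef_apply, coef_apply, op_mul_apply]
  by_contra h0
  let M := (regular μ).restrict Sᗮ hinv
  have : Nontrivial M.space :=
    ⟨⟨(⟨f, (hS f).2 hf⟩ : Sᗮ), (0 : Sᗮ), fun h => h0 (congrArg Subtype.val h)⟩⟩
  obtain ⟨W, hW0, hWf, hWi⟩ := exists_finiteDimensional_isInvariant M
  change Submodule ℂ Sᗮ at W
  let W' : Submodule ℂ (Lp ℂ 2 μ) := W.map Sᗮ.subtype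
  have : FiniteDimensional ℂ W := hWf
  have : FiniteDimensional ℂ W' := inferInstance
  have hW' : (regular μ).IsInvariant W' := by
    rintro g _ ⟨z, hz, rfl⟩
    exact ⟨_, hWi g z hz, rfl⟩
  obtain ⟨z, hz, hz0⟩ := (Submodule.ne_bot_iff W).1 hW0
  have hzW : (z : Lp ℂ 2 μ) ∈ W' := ⟨z, hz, rfl⟩
  obtain ⟨y, hy, hye⟩ := exists_ae_eq_inner_regular μ hW' hzW
  -- The regular representation restricted to `W'` exhibits `z` as a matrix coefficient. So `z` lies
  -- both in `S` and in its orthogonal complement, although `z ≠ 0`.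
  have hp : (regular μ).coef y (z : Lp ℂ 2 μ) ∈ finiteCoefs K :=
    ⟨(regular μ).restrict W' hW', inferInstanceAs (FiniteDimensional ℂ W'), ⟨y, hy⟩, ⟨z, hzW⟩, rfl⟩
  have hzp : (z : Lp ℂ 2 μ) = ContinuousMap.toLp (E := ℂ) 2 μ ℂ ((regular μ).coef y (z : Lp ℂ 2 μ)) :=
    Lp.ext (hye.trans (ContinuousMap.coeFn_toLp (p := 2) μ (𝕜 := ℂ) _).symm)
  have := (hS _).1 z.2 _ hp
  rw [← hzp, inner_self_eq_zero] at this
  exact hz0 (Subtype.ext this)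

end PeterWeyl

/-! ### Matrix coefficients of powers of the group -/

section Products

variable {G : Type*} [Group G] [TopologicalSpace G] (Λ : IrrepSet.{u, w} G) {E : Type*}

/-- The products over `s` of matrix coefficients of representations in `Λ`, as functions
on `G^E`. -/
def prodCoefs (s : Finset E) : Set C(E → G, ℂ) :=
  {p | ∃ f : E → C(G, ℂ), (∀ e ∈ s, f e ∈ Λ.coefs) ∧
    p = ∏ e ∈ s, (f e).comp (ContinuousMap.eval e)}

variable [DecidableEq E]

theorem continuous_piecewise_one (s : Finset E) :
    Continuous fun a : E → G => s.piecewise a 1 := by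
  refine continuous_pi fun e => ?_
  by_cases he : e ∈ s
  · simpa [he] using continuous_apply e
  · simpa [he] using continuous_const

/-- The function `a ↦ ⟪y, σ(a|ₛ) x⟫`. -/
def partialCoef (σ : UnitaryRep.{u₁} (E → G)) (s : Finset E) (y x : σ.space) : C(E → G, ℂ) :=
  (σ.coef y x).comp ⟨_, continuous_piecewise_one s⟩

/-- Since `σ(a|_{s ∪ {e}}) = σ(a_e) σ(a|_s)`, inserting an orthonormal basis between the two
operators splits off a coefficient of `σ` restricted to the factor `e`, to which `coef_mem_span`
applies. No classification of the irreducible representations of `G^E` is needed. -/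
theorem partialCoef_mem_span (σ : UnitaryRep.{u₁} (E → G)) [FiniteDimensional ℂ σ.space]
    (s : Finset E) (y x : σ.space) :
    partialCoef σ s y x ∈ Submodule.span ℂ (prodCoefs Λ s) := by
  induction s using Finset.induction_on generalizing y x with
  | empty =>
    have h1 : (1 : C(E → G, ℂ)) ∈ prodCoefs Λ ∅ := ⟨0, by simp, by simp⟩
    have h2 : partialCoef σ ∅ y x = ⟪y, x⟫_ℂ • (1 : C(E → G, ℂ)) := by
      ext a
      change ⟪y, σ.op ((∅ : Finset E).piecewise a 1) x⟫_ℂ = ⟪y, x⟫_ℂ * 1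
      rw [Finset.piecewise_empty, op_one_apply, mul_one]
    rw [h2]
    exact Submodule.smul_mem _ _ (Submodule.subset_span h1)
  | insert e s he ih =>
    let π : UnitaryRep.{u₁} G :=
      σ.comap (MonoidHom.mulSingle (fun _ => G) e) (continuous_mulSingle (A := fun _ => G) e)
    have : FiniteDimensional ℂ π.space := inferInstanceAs (FiniteDimensional ℂ σ.space)
    let b := stdOrthonormalBasis ℂ σ.space
    have hpw : ∀ a : E → G,
        (insert e s).piecewise a 1 = Pi.mulSingle e (a e) * s.piecewise a 1 := fun a => by
      ext e'
      by_cases h : e' = e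
      · subst h
        simp [he]
      · by_cases h' : e' ∈ s <;> simp [h, h']
    have hsum : partialCoef σ (insert e s) y x =
        ∑ i, (π.coef y (b i)).comp (ContinuousMap.eval e) * partialCoef σ s (b i) x := by
      ext a
      rw [ContinuousMap.sum_apply]
      change ⟪y, σ.op ((insert e s).piecewise a 1) x⟫_ℂ =
        ∑ i, ⟪y, σ.op (Pi.mulSingle e (a e)) (b i)⟫_ℂ * ⟪b i, σ.op (s.piecewise a 1) x⟫_ℂ
      simp only [hpw, op_mul_apply, inner_op_right σ (Pi.mulSingle e (a e)) y]
      rw [b.sum_inner_mul_inner]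
    rw [hsum]
    refine Submodule.sum_mem _ fun i _ => ?_
    have h1 : (π.coef y (b i)).comp (ContinuousMap.eval e : C(E → G, G)) ∈ Submodule.span ℂ
        ((fun f : C(G, ℂ) => f.comp (ContinuousMap.eval e : C(E → G, G))) '' Λ.coefs) := by
      have := Submodule.mem_map_of_mem (f := (ContinuousMap.compRightAlgHom ℂ ℂ
        (ContinuousMap.eval e : C(E → G, G))).toLinearMap) (coef_mem_span Λ π y (b i))
      rwa [Submodule.map_span] at this
    have h2 := Submodule.mul_mem_mul h1 (ih (b i) x)
    rw [Submodule.span_mul_span] at h2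
    refine Submodule.span_mono ?_ h2
    rintro _ ⟨_, ⟨f, hf, rfl⟩, _, ⟨f', hf', rfl⟩, rfl⟩
    refine ⟨Function.update f' e f, fun e' he' => ?_, ?_⟩
    · by_cases h : e' = e
      · subst h
        simpa using hf
      · rw [Function.update_of_ne h]
        exact hf' e' (Finset.mem_of_mem_insert_of_ne he' h)
    · rw [Finset.prod_insert he, Function.update_self]
      congr 1
      exact Finset.prod_congr rfl fun e' h' => by
        rw [Function.update_of_ne (ne_of_mem_of_not_mem h' he)]

end Products

section PeterWeylPower

variable {G : Type*} [Group G] [TopologicalSpace G] [IsTopologicalGroup G] [CompactSpace G]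
  [SecondCountableTopology G] [T2Space G] [MeasurableSpace G] [BorelSpace G] (μ : Measure G)
  [IsProbabilityMeasure μ] [μ.IsHaarMeasure] (Λ : IrrepSet.{u, w} G) {E : Type*} [Fintype E]

/-- **Peter–Weyl theorem** for `G^E`, in terms of the irreducible representations of `G`. -/
theorem eq_zero_of_orthogonal_prod_coef (f : Lp ℂ 2 (Measure.pi fun _ : E => μ))
    (hf : ∀ (ρ : E → Λ.Label) (y x : ∀ e, Λ.space (ρ e)),
      ∫ a, starRingEnd ℂ (∏ e, (Λ.rep (ρ e)).coef (y e) (x e) (a e)) * f a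
        ∂(Measure.pi fun _ : E => μ) = 0) : f = 0 := by
  classical
  have := isMulRightInvariant_of_compactSpace (Measure.pi fun _ : E => μ)
  refine eq_zero_of_orthogonal_finiteCoefs _ f ?_
  rintro _ ⟨σ, hσ, y, x, rfl⟩
  have hs := partialCoef_mem_span Λ σ Finset.univ y x
  have he : partialCoef σ Finset.univ y x = σ.coef y x := by
    ext a
    change σ.coef y x (Finset.univ.piecewise a 1) = _
    rw [Finset.piecewise_univ]
  rw [he] at hs
  generalize σ.coef y x = p at hs
  induction hs using Submodule.span_induction with
  | zero => simp
  | add p q _ _ hp hq => rw [map_add, inner_add_left, hp, hq, add_zero]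
  | smul c p _ hp => rw [map_smul, inner_smul_left, hp, mul_zero]
  | mem p hp =>
    obtain ⟨F, hF, rfl⟩ := hp
    choose ρ y x hF using fun e => hF e (Finset.mem_univ e)
    rw [L2.inner_def, ← hf ρ y x]
    refine integral_congr_ae ?_
    filter_upwards [ContinuousMap.coeFn_toLp (p := 2) (Measure.pi fun _ : E => μ) (𝕜 := ℂ)
      (∏ e, (F e).comp (ContinuousMap.eval e))] with a ha
    rw [ha, RCLike.inner_apply', ContinuousMap.prod_apply]
    simp only [hF]
    rfl

end PeterWeylPower

end UnitaryRep

/-! ### Spanning sets and functionals on Hilbert tensor products -/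

namespace HTensor

variable {ι : Type*} {H K : ι → Type*} [∀ i, NormedAddCommGroup (H i)]
  [∀ i, InnerProductSpace ℂ (H i)] [∀ i, NormedAddCommGroup (K i)]
  [∀ i, InnerProductSpace ℂ (K i)]

/-- Pure tensors of spanning sets span the tensor product. -/
theorem span_tprod_eq_top [Finite ι] (s : ∀ i, Set (H i))
    (hs : ∀ i, Submodule.span ℂ (s i) = ⊤) :
    Submodule.span ℂ {t : HTensor H | ∃ x : ∀ i, H i, (∀ i, x i ∈ s i) ∧ t = tprod x} = ⊤ := by
  classical
  have := Fintype.ofFinite ι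
  set M := Submodule.span ℂ {t : HTensor H | ∃ x : ∀ i, H i, (∀ i, x i ∈ s i) ∧ t = tprod x}
  -- `t` is the set of indices at which the factor may still be arbitrary; it grows from `∅` to
  -- everything by linearity in one factor at a time.
  have key : ∀ (t : Finset ι) (x : ∀ i, H i), (∀ i ∉ t, x i ∈ s i) → tprod x ∈ M := by
    intro t
    induction t using Finset.induction_on with
    | empty => exact fun x hx => Submodule.subset_span ⟨x, fun i => hx i (Finset.notMem_empty i), rfl⟩
    | insert i t hi ih =>
      intro x hx
      have hz : ∀ z ∈ Submodule.span ℂ (s i), tprod (Function.update x i z) ∈ M := by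
        intro z hz
        induction hz using Submodule.span_induction with
        | mem z hz =>
          refine ih _ fun j hj => ?_
          by_cases h : j = i
          · subst h
            simpa using hz
          · rw [Function.update_of_ne h]
            exact hx j fun h' => (Finset.mem_insert.1 h').elim h hj
        | zero => rw [MultilinearMap.map_update_zero]; exact M.zero_mem
        | add z z' _ _ h h' => rw [MultilinearMap.map_update_add]; exact M.add_mem h h'
        | smul c z _ h => rw [MultilinearMap.map_update_smul]; exact M.smul_mem c h
      have := hz (x i) (by rw [hs]; trivial)
      rwa [Function.update_eq_self] at this
  refine (Submodule.eq_top_iff').2 fun t => ?_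
  induction t using HTensor.induction with
  | hs c x => exact M.smul_mem c (key Finset.univ x fun i hi => absurd (Finset.mem_univ i) hi)
  | ha x y hx hy => exact M.add_mem hx hy

instance [Finite ι] [∀ i, FiniteDimensional ℂ (H i)] : FiniteDimensional ℂ (HTensor H) :=
  Module.Basis.finiteDimensional_of_finite
    (Basis.piTensorProduct fun i => Module.finBasis ℂ (H i) : Module.Basis _ ℂ (HTensor H))

/-- The linear functional `⨂ xᵢ ↦ ∏ fᵢ xᵢ`. -/
def prodFunctional [Fintype ι] (f : ∀ i, H i →ₗ[ℂ] ℂ) : HTensor H →ₗ[ℂ] ℂ :=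
  PiTensorProduct.lift ((MultilinearMap.mkPiAlgebra ℂ ι ℂ).compLinearMap f)

theorem prodFunctional_tprod [Fintype ι] (f : ∀ i, H i →ₗ[ℂ] ℂ) (x : ∀ i, H i) :
    prodFunctional f (tprod x) = ∏ i, f i (x i) :=
  (PiTensorProduct.lift.tprod x).trans (by simp)

theorem inner_map_map [Finite ι] (f : ∀ i, H i →ₗᵢ[ℂ] K i) (x y : HTensor H) :
    ⟪map (fun i => (f i).toLinearMap) x, map (fun i => (f i).toLinearMap) y⟫_ℂ = ⟪x, y⟫_ℂ :=
  @innerForm_map _ _ _ _ _ _ _ (Fintype.ofFinite ι) f y x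

theorem inner_map_subtype [Finite ι] (W : ∀ i, Submodule ℂ (H i)) (x y : HTensor fun i => W i) :
    ⟪map (fun i => (W i).subtype) x, map (fun i => (W i).subtype) y⟫_ℂ = ⟪x, y⟫_ℂ :=
  inner_map_map (fun i => (W i).subtypeₗᵢ) x y

theorem orthonormal_tprod [Finite ι] {κ : ι → Type*} {b : ∀ i, κ i → H i}
    (hb : ∀ i, Orthonormal ℂ (b i)) :
    Orthonormal ℂ fun p : ∀ i, κ i => (tprod fun i => b i (p i) : HTensor H) := by
  classical
  have := Fintype.ofFinite ι
  rw [orthonormal_iff_ite]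
  intro p q
  rw [inner_tprod]
  simp only [fun i => orthonormal_iff_ite.1 (hb i)]
  rw [Finset.prod_ite_zero]
  simp [funext_iff]

end HTensor

/-! ### Vertex spaces and their invariants -/

section Vertex

variable {G : Type*} [Group G] [TopologicalSpace G] (Λ : IrrepSet.{u, w} G)
  {V E : Type*} (φ : DiGraph V E)

/-- The pure tensor with factors `x_e` at the source and `y_e` at the target of each edge. -/
def pureVertex (ρ : E → Λ.Label) (x : ∀ e, Λ.space (ρ e)) (y : ∀ e, Λ.space (Λ.dual (ρ e)))
    (v : V) : VertexSpace Λ φ ρ v :=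
  HTensor.tprod (fun e : φ.S v => x e) ⊗ₜ[ℂ] HTensor.tprod (fun e : φ.T v => y e)

theorem span_tmul_tprod (ρ : E → Λ.Label) (v : V) :
    Submodule.span ℂ {t : VertexSpace Λ φ ρ v | ∃ (x : ∀ e : φ.S v, Λ.space (ρ e))
      (y : ∀ e : φ.T v, Λ.space (Λ.dual (ρ e))), t = HTensor.tprod x ⊗ₜ[ℂ] HTensor.tprod y} =
      ⊤ := by
  set M := Submodule.span ℂ {t : VertexSpace Λ φ ρ v | ∃ (x : ∀ e : φ.S v, Λ.space (ρ e))
    (y : ∀ e : φ.T v, Λ.space (Λ.dual (ρ e))), t = HTensor.tprod x ⊗ₜ[ℂ] HTensor.tprod y}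
  refine (Submodule.eq_top_iff').2 fun t => ?_
  induction t using TensorProduct.induction_on with
  | zero => exact M.zero_mem
  | add s t hs ht => exact M.add_mem hs ht
  | tmul a b =>
    induction a using HTensor.induction with
    | ha a a' h h' => rw [TensorProduct.add_tmul]; exact M.add_mem h h'
    | hs c x =>
      rw [← TensorProduct.smul_tmul']
      refine M.smul_mem c ?_
      induction b using HTensor.induction with
      | ha b b' h h' => rw [TensorProduct.tmul_add]; exact M.add_mem h h'
      | hs c y =>
        rw [TensorProduct.tmul_smul]
        exact M.smul_mem c (Submodule.subset_span ⟨x, y, rfl⟩)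

theorem vertexOp_tmul (ρ : E → Λ.Label) (v : V) (g : G) (x : ∀ e : φ.S v, Λ.space (ρ e))
    (y : ∀ e : φ.T v, Λ.space (Λ.dual (ρ e))) :
    vertexOp Λ φ ρ v g (HTensor.tprod x ⊗ₜ[ℂ] HTensor.tprod y) =
      HTensor.tprod (fun e : φ.S v => (Λ.rep (ρ e)).op g (x e)) ⊗ₜ[ℂ]
        HTensor.tprod (fun e : φ.T v => (Λ.rep (Λ.dual (ρ e))).op g (y e)) := by
  rw [vertexOp, TensorProduct.map_tmul, HTensor.map_tprod, HTensor.map_tprod]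
  rfl

theorem vertexOp_ext {ρ : E → Λ.Label} {v : V} {M : Type*} [AddCommGroup M] [Module ℂ M]
    {f f' : VertexSpace Λ φ ρ v →ₗ[ℂ] M}
    (h : ∀ x y, f (HTensor.tprod x ⊗ₜ[ℂ] HTensor.tprod y) =
      f' (HTensor.tprod x ⊗ₜ[ℂ] HTensor.tprod y)) : f = f' := by
  refine LinearMap.ext_on (span_tmul_tprod Λ φ ρ v) ?_
  rintro _ ⟨x, y, rfl⟩
  exact h x y

theorem vertexOp_one (ρ : E → Λ.Label) (v : V) : vertexOp Λ φ ρ v 1 = LinearMap.id :=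
  vertexOp_ext Λ φ fun x y => by
    simp only [vertexOp_tmul, UnitaryRep.op_one_apply, LinearMap.id_apply]

theorem vertexOp_mul_apply (ρ : E → Λ.Label) (v : V) (g h : G) (t : VertexSpace Λ φ ρ v) :
    vertexOp Λ φ ρ v (g * h) t = vertexOp Λ φ ρ v g (vertexOp Λ φ ρ v h t) := by
  have : vertexOp Λ φ ρ v (g * h) = vertexOp Λ φ ρ v g ∘ₗ vertexOp Λ φ ρ v h :=
    vertexOp_ext Λ φ fun x y => by
      simp only [vertexOp_tmul, UnitaryRep.op_mul_apply, LinearMap.comp_apply]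
  rw [this]
  rfl

variable [Finite E]

/-- The pure tensor with factors `x_e` and `y_e` for each edge. -/
def pureTensor (ρ : E → Λ.Label) (x : ∀ e, Λ.space (ρ e)) (y : ∀ e, Λ.space (Λ.dual (ρ e))) :
    HTensor (VertexSpace Λ φ ρ) :=
  HTensor.tprod (pureVertex Λ φ ρ x y)

/-- Each edge occurs once among the outgoing edges of a vertex and once among the incoming ones. So
independent choices of factors at all vertices amount to one `x_e` and one `y_e` for each edge. -/
theorem span_pureTensor [Finite V] (ρ : E → Λ.Label) :
    Submodule.span ℂ {t | ∃ x y, t = pureTensor Λ φ ρ x y} = ⊤ := by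
  rw [eq_top_iff, ← HTensor.span_tprod_eq_top _ (span_tmul_tprod Λ φ ρ)]
  refine Submodule.span_mono ?_
  rintro _ ⟨z, hz, rfl⟩
  choose x y hxy using hz
  refine ⟨fun e => x (φ.source e) ⟨e, rfl⟩, fun e => y (φ.target e) ⟨e, rfl⟩, ?_⟩
  refine congrArg HTensor.tprod (funext fun v => (hxy v).trans ?_)
  refine congrArg₂ (fun a b => HTensor.tprod a ⊗ₜ[ℂ] HTensor.tprod b) ?_ ?_
  · funext ⟨e, he⟩
    subst he
    rfl
  · funext ⟨e, he⟩
    subst he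
    rfl

theorem inner_vertexOp_vertexOp (ρ : E → Λ.Label) (v : V) (g : G) (s t : VertexSpace Λ φ ρ v) :
    ⟪vertexOp Λ φ ρ v g s, vertexOp Λ φ ρ v g t⟫_ℂ = ⟪s, t⟫_ℂ := by
  induction s using TensorProduct.induction_on with
  | zero => simp
  | add s s' h h' => rw [map_add, inner_add_left, inner_add_left, h, h']
  | tmul a b =>
    induction t using TensorProduct.induction_on with
    | zero => simp
    | add s s' h h' => rw [map_add, inner_add_right, inner_add_right, h, h']
    | tmul a' b' =>
      rw [vertexOp, TensorProduct.map_tmul, TensorProduct.map_tmul, TensorProduct.inner_tmul,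
        TensorProduct.inner_tmul]
      congr 1
      · exact HTensor.inner_map_map
          (fun e : φ.S v => ((Λ.rep (ρ e)).op g).toLinearIsometry) a a'
      · exact HTensor.inner_map_map
          (fun e : φ.T v => ((Λ.rep (Λ.dual (ρ e))).op g).toLinearIsometry) b b'

section Compact

variable [IsTopologicalGroup G] [CompactSpace G]

instance (l : Λ.Label) : FiniteDimensional ℂ (Λ.space l) := (Λ.irreducible l).finiteDimensional

/-- An invariant linear functional does not see the orthogonal complement of the invariants. -/
theorem apply_starProjection_inv (ρ : E → Λ.Label) (v : V) {f : VertexSpace Λ φ ρ v →ₗ[ℂ] ℂ}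
    (hf : ∀ g t, f (vertexOp Λ φ ρ v g t) = f t) (t : VertexSpace Λ φ ρ v) :
    f ((Inv Λ φ ρ v).starProjection t) = f t := by
  -- The Riesz vector of an invariant functional is itself invariant, because the vertex operators
  -- are unitary; hence it is orthogonal to the complement of the invariants.
  let u := (InnerProductSpace.toDual ℂ _).symm (LinearMap.toContinuousLinearMap f)
  have hu : ∀ t, ⟪u, t⟫_ℂ = f t := fun t => InnerProductSpace.toDual_symm_apply
  have hinv : u ∈ Inv Λ φ ρ v := fun g => by
    refine ext_inner_right ℂ fun t => ?_
    have : t = vertexOp Λ φ ρ v g (vertexOp Λ φ ρ v g⁻¹ t) := by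
      rw [← vertexOp_mul_apply, mul_inv_cancel, vertexOp_one]
      rfl
    rw [this, inner_vertexOp_vertexOp, ← this, hu, hu, hf]
  rw [eq_comm, ← sub_eq_zero, ← map_sub, ← hu]
  exact Submodule.inner_right_of_mem_orthogonal hinv
    (Submodule.sub_starProjection_mem_orthogonal t)

/-- A gauge-invariant linear functional that vanishes on the tensor products of invariants
vanishes. -/
theorem eq_zero_of_forall_inv [Finite V] (ρ : E → Λ.Label)
    {f : HTensor (VertexSpace Λ φ ρ) →ₗ[ℂ] ℂ}
    (hf : ∀ (k : V → G) t, f (HTensor.map (fun v => vertexOp Λ φ ρ v (k v)) t) = f t)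
    (h0 : ∀ ι : ∀ v, Inv Λ φ ρ v, f (HTensor.tprod fun v => (ι v).1) = 0) : f = 0 := by
  classical
  have := Fintype.ofFinite V
  -- `s` is the set of vertices whose factor need not be invariant. To enlarge it by `v`, replace
  -- the factor at `v` by its projection to the invariants, which does not change the value of `f`.
  have key : ∀ (s : Finset V) (z : ∀ v, VertexSpace Λ φ ρ v),
      (∀ v ∉ s, z v ∈ Inv Λ φ ρ v) → f (HTensor.tprod z) = 0 := by
    intro s
    induction s using Finset.induction_on with
    | empty => exact fun z hz => h0 fun v => ⟨z v, hz v (Finset.notMem_empty v)⟩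
    | insert v s hv ih =>
      intro z hz
      let f' : VertexSpace Λ φ ρ v →ₗ[ℂ] ℂ := f ∘ₗ HTensor.tprod.toLinearMap z v
      have hf' : ∀ g t, f' (vertexOp Λ φ ρ v g t) = f' t := fun g t => by
        change f (HTensor.tprod (Function.update z v _)) = f (HTensor.tprod (Function.update z v t))
        -- A gauge transformation concentrated at `v` shows that `f`, as a functional of the factor
        -- at `v` alone, is invariant.
        rw [← hf (Pi.mulSingle v g) (HTensor.tprod (Function.update z v t)), HTensor.map_tprod]
        congr 2
        funext v'
        by_cases h : v' = v
        · subst h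
          simp
        · rw [Function.update_of_ne h, Function.update_of_ne h, Pi.mulSingle_eq_of_ne h,
            vertexOp_one]
          rfl
      have h1 : f' (z v) = f (HTensor.tprod z) := by
        change f (HTensor.tprod (Function.update z v (z v))) = _
        rw [Function.update_eq_self]
      rw [← h1, ← apply_starProjection_inv Λ φ ρ v hf']
      refine ih _ fun v' hv' => ?_
      by_cases h : v' = v
      · subst h
        rw [Function.update_self]
        exact Submodule.starProjection_apply_mem _ _
      · rw [Function.update_of_ne h]
        exact hz v' fun h' => (Finset.mem_insert.1 h').elim h hv'
  ext t
  induction t using HTensor.induction with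
  | hs c z =>
    rw [map_smul, key Finset.univ z fun v hv => absurd (Finset.mem_univ v) hv]
    simp
  | ha s t hs ht => rw [map_add, hs, ht]; simp

end Compact

end Vertex

/-! ### From tensors to functions on `G^E` -/

section CoefMap

variable {G : Type*} [Group G] [TopologicalSpace G] {Λ : IrrepSet.{u, w} G}
  {V E : Type*} (φ : DiGraph V E)
  (J : ∀ l, (Λ.rep (Λ.dual l)).Equivalence (Λ.rep l).dual)

/-- The vector that represents the functional `J y`. -/
def rieszJ {l : Λ.Label} (y : Λ.space (Λ.dual l)) : Λ.space l :=
  (InnerProductSpace.toDual ℂ (Λ.space l)).symm ((J l).toLinearIsometryEquiv y)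

/-- The functional `J y`. -/
def functional {l : Λ.Label} (y : Λ.space (Λ.dual l)) : StrongDual ℂ (Λ.space l) :=
  (J l).toLinearIsometryEquiv y

theorem functional_apply {l : Λ.Label} (y : Λ.space (Λ.dual l)) (x : Λ.space l) :
    functional J y x = ⟪rieszJ J y, x⟫_ℂ :=
  InnerProductSpace.toDual_symm_apply.symm

theorem functional_add {l : Λ.Label} (y y' : Λ.space (Λ.dual l)) :
    functional J (y + y') = functional J y + functional J y' :=
  map_add (J l).toLinearIsometryEquiv y y'

theorem functional_smul {l : Λ.Label} (c : ℂ) (y : Λ.space (Λ.dual l)) :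
    functional J (c • y) = c • functional J y :=
  map_smul (J l).toLinearIsometryEquiv c y

theorem functional_op {l : Λ.Label} (g : G) (y : Λ.space (Λ.dual l)) (x : Λ.space l) :
    functional J ((Λ.rep (Λ.dual l)).op g y) x = functional J y ((Λ.rep l).op g⁻¹ x) :=
  congrArg (fun f : StrongDual ℂ (Λ.space l) => f x) ((J l).intertwines g y)

/-- `J` is unitary and the Riesz isomorphism is conjugate-linear; hence the reversed order. -/
theorem inner_rieszJ {l : Λ.Label} (y y' : Λ.space (Λ.dual l)) :
    ⟪rieszJ J y', rieszJ J y⟫_ℂ = ⟪y, y'⟫_ℂ :=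
  (J l).toLinearIsometryEquiv.inner_map_map y y'

theorem rieszJ_surjective {l : Λ.Label} : Function.Surjective (rieszJ J (l := l)) := fun x => by
  obtain ⟨y, hy⟩ := (J l).toLinearIsometryEquiv.surjective (InnerProductSpace.toDual ℂ _ x)
  exact ⟨y, by rw [rieszJ, hy, LinearIsometryEquiv.symm_apply_apply]⟩

variable [Fintype E]

/-- The normalized product of matrix coefficients that belongs to a pure tensor. -/
def pureCoef (ρ : E → Λ.Label) (x : ∀ e, Λ.space (ρ e)) (y : ∀ e, Λ.space (Λ.dual (ρ e)))
    (a : E → G) : ℂ :=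
  ∏ e, (Real.sqrt (Module.finrank ℂ (Λ.space (ρ e))) : ℂ) *
    functional J (y e) ((Λ.rep (ρ e)).op (a e) (x e))

/-- The action of `G^V` on `G^E` by gauge transformations. -/
def gaugeAct (k : V → G) (a : E → G) : E → G :=
  fun e => k (φ.target e) * a e * (k (φ.source e))⁻¹

/-- `k` at the source acts on `x_e` directly; `k` at the target passes to `y_e`, because `J`
intertwines with the dual representation. -/
theorem pureCoef_gaugeAct (ρ : E → Λ.Label) (x : ∀ e, Λ.space (ρ e))
    (y : ∀ e, Λ.space (Λ.dual (ρ e))) (k : V → G) (a : E → G) :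
    pureCoef J ρ x y (gaugeAct φ k a) =
      pureCoef J ρ (fun e => (Λ.rep (ρ e)).op (k (φ.source e))⁻¹ (x e))
        (fun e => (Λ.rep (Λ.dual (ρ e))).op (k (φ.target e))⁻¹ (y e)) a := by
  refine Finset.prod_congr rfl fun e _ => ?_
  simp only [functional_op, gaugeAct, UnitaryRep.op_mul_apply, inv_inv]

theorem continuous_pureCoef (ρ : E → Λ.Label) (x : ∀ e, Λ.space (ρ e))
    (y : ∀ e, Λ.space (Λ.dual (ρ e))) : Continuous (pureCoef J ρ x y) :=
  continuous_finsetProd _ fun e _ => continuous_const.mul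
    ((functional J (y e)).continuous.comp
      (((Λ.rep (ρ e)).continuous_op (x e)).comp (continuous_apply e)))

theorem map_vertexOp_pureTensor (ρ : E → Λ.Label) (x : ∀ e, Λ.space (ρ e))
    (y : ∀ e, Λ.space (Λ.dual (ρ e))) (k : V → G) :
    HTensor.map (fun v => vertexOp Λ φ ρ v (k v)) (pureTensor Λ φ ρ x y) =
      pureTensor Λ φ ρ (fun e => (Λ.rep (ρ e)).op (k (φ.source e)) (x e))
        (fun e => (Λ.rep (Λ.dual (ρ e))).op (k (φ.target e)) (y e)) := by
  rw [pureTensor, HTensor.map_tprod]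
  refine congrArg HTensor.tprod (funext fun v => ?_)
  rw [pureVertex, vertexOp_tmul]
  refine congrArg₂ (fun a b => HTensor.tprod a ⊗ₜ[ℂ] HTensor.tprod b) ?_ ?_
  · funext ⟨e, he⟩
    subst he
    rfl
  · funext ⟨e, he⟩
    subst he
    rfl

/-- The inclusion of the tensor product of the invariants. -/
def invInclusion (ρ : E → Λ.Label) : InvTensor Λ φ ρ →ₗ[ℂ] HTensor (VertexSpace Λ φ ρ) :=
  HTensor.map fun v => (Inv Λ φ ρ v).subtype

theorem invInclusion_tprod (ρ : E → Λ.Label) (ι : ∀ v, Inv Λ φ ρ v) :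
    invInclusion φ ρ (HTensor.tprod ι) = HTensor.tprod fun v => (ι v).1 :=
  HTensor.map_tprod _ ι

section PureIntegral

variable [IsTopologicalGroup G] [CompactSpace G] [MeasurableSpace G] [BorelSpace G]
  (μ : Measure G) [IsProbabilityMeasure μ] [μ.IsHaarMeasure]

/-- Fubini reduces this to one edge at a time, where the two factors `(dim ρ_e)^{1/2}` cancel the
dimension in Schur orthogonality. -/
theorem integral_pureCoef (ρ : E → Λ.Label) (x x' : ∀ e, Λ.space (ρ e))
    (y y' : ∀ e, Λ.space (Λ.dual (ρ e))) :
    ∫ a, starRingEnd ℂ (pureCoef J ρ x y a) * pureCoef J ρ x' y' a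
      ∂(Measure.pi fun _ : E => μ) = ∏ e, ⟪x e, x' e⟫_ℂ * ⟪y e, y' e⟫_ℂ := by
  simp only [pureCoef, map_prod, ← Finset.prod_mul_distrib]
  rw [integral_fintype_prod_eq_prod (fun e g => starRingEnd ℂ
    ((Real.sqrt (Module.finrank ℂ (Λ.space (ρ e))) : ℂ) *
      functional J (y e) ((Λ.rep (ρ e)).op g (x e))) *
    ((Real.sqrt (Module.finrank ℂ (Λ.space (ρ e))) : ℂ) *
      functional J (y' e) ((Λ.rep (ρ e)).op g (x' e))))]
  refine Finset.prod_congr rfl fun e _ => ?_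
  rw [← inner_rieszJ J (y e), ← UnitaryRep.integral_coef μ (Λ.irreducible (ρ e)),
    ← integral_const_mul]
  congr 1
  ext g
  have hs : (Real.sqrt (Module.finrank ℂ (Λ.space (ρ e))) : ℂ) *
      (Real.sqrt (Module.finrank ℂ (Λ.space (ρ e))) : ℂ) = Module.finrank ℂ (Λ.space (ρ e)) := by
    rw [← Complex.ofReal_mul, Real.mul_self_sqrt (Nat.cast_nonneg _), Complex.ofReal_natCast]
  rw [map_mul, Complex.conj_ofReal, functional_apply, functional_apply, inner_conj_symm, ← hs]
  ring

/-- At an edge where the labels differ the representations are inequivalent, `Λ` having one member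
in each class, so that factor of the product is zero. -/
theorem integral_pureCoef_of_ne {ρ ρ' : E → Λ.Label} (h : ρ ≠ ρ') (x : ∀ e, Λ.space (ρ e))
    (y : ∀ e, Λ.space (Λ.dual (ρ e))) (x' : ∀ e, Λ.space (ρ' e))
    (y' : ∀ e, Λ.space (Λ.dual (ρ' e))) :
    ∫ a, starRingEnd ℂ (pureCoef J ρ x y a) * pureCoef J ρ' x' y' a
      ∂(Measure.pi fun _ : E => μ) = 0 := by
  obtain ⟨e, he⟩ := Function.ne_iff.1 h
  simp only [pureCoef, map_prod, ← Finset.prod_mul_distrib]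
  rw [integral_fintype_prod_eq_prod (fun e g => starRingEnd ℂ
    ((Real.sqrt (Module.finrank ℂ (Λ.space (ρ e))) : ℂ) *
      functional J (y e) ((Λ.rep (ρ e)).op g (x e))) *
    ((Real.sqrt (Module.finrank ℂ (Λ.space (ρ' e))) : ℂ) *
      functional J (y' e) ((Λ.rep (ρ' e)).op g (x' e))))]
  refine Finset.prod_eq_zero (Finset.mem_univ e) ?_
  have hne : ¬ Nonempty ((Λ.rep (ρ e)).Equivalence (Λ.rep (ρ' e))) := fun hT => he
    ((Λ.existsUnique _ (Λ.irreducible (ρ e))).unique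
      ⟨⟨LinearIsometryEquiv.refl ℂ _, fun _ _ => rfl⟩⟩ hT)
  have h0 := UnitaryRep.integral_coef_of_not_equivalent μ (Λ.irreducible (ρ e))
    (Λ.irreducible (ρ' e)) hne (x e) (rieszJ J (y e)) (x' e) (rieszJ J (y' e))
  rw [← mul_zero ((Real.sqrt (Module.finrank ℂ (Λ.space (ρ e))) : ℂ) *
    (Real.sqrt (Module.finrank ℂ (Λ.space (ρ' e))) : ℂ)), ← h0, ← integral_const_mul]
  congr 1
  ext g
  rw [map_mul, Complex.conj_ofReal, functional_apply, functional_apply, inner_conj_symm]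
  ring

theorem measurePreserving_gaugeAct (k : V → G) :
    MeasurePreserving (gaugeAct φ k) (Measure.pi fun _ : E => μ) (Measure.pi fun _ : E => μ) := by
  have := isMulRightInvariant_of_compactSpace μ
  exact measurePreserving_pi (fun _ : E => μ) (fun _ => μ) fun e =>
    (measurePreserving_mul_right μ _).comp (measurePreserving_mul_left μ _)

end PureIntegral

variable [Finite V]

theorem pure_induction {ρ : E → Λ.Label} {p : HTensor (VertexSpace Λ φ ρ) → Prop}
    (t : HTensor (VertexSpace Λ φ ρ)) (hp : ∀ x y, p (pureTensor Λ φ ρ x y)) (h0 : p 0)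
    (ha : ∀ s t, p s → p t → p (s + t)) (hs : ∀ (c : ℂ) t, p t → p (c • t)) : p t := by
  have ht : t ∈ Submodule.span ℂ {t | ∃ x y, t = pureTensor Λ φ ρ x y} := by
    rw [span_pureTensor]; trivial
  induction ht using Submodule.span_induction with
  | mem t ht =>
    obtain ⟨x, y, rfl⟩ := ht
    exact hp x y
  | zero => exact h0
  | add s t _ _ h h' => exact ha s t h h'
  | smul c t _ h => exact hs c t h

theorem inner_invInclusion (ρ : E → Λ.Label) (s t : InvTensor Λ φ ρ) :
    ⟪invInclusion φ ρ s, invInclusion φ ρ t⟫_ℂ = ⟪s, t⟫_ℂ :=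
  HTensor.inner_map_subtype (Inv Λ φ ρ) s t

/-- Grouping the edges by source and by target turns the product over vertices into one over edges.
The result is the right-hand side of `integral_pureCoef`, which makes `coefMap` isometric. -/
theorem inner_pureTensor (ρ : E → Λ.Label) (x x' : ∀ e, Λ.space (ρ e))
    (y y' : ∀ e, Λ.space (Λ.dual (ρ e))) :
    ⟪pureTensor Λ φ ρ x y, pureTensor Λ φ ρ x' y'⟫_ℂ =
      ∏ e, ⟪x e, x' e⟫_ℂ * ⟪y e, y' e⟫_ℂ := by
  classical
  let := Fintype.ofFinite V
  rw [pureTensor, pureTensor, HTensor.inner_tprod, Finset.prod_mul_distrib,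
    ← Fintype.prod_fiberwise φ.source, ← Fintype.prod_fiberwise φ.target,
    ← Finset.prod_mul_distrib]
  refine Finset.prod_congr rfl fun v _ => ?_
  rw [pureVertex, pureVertex, TensorProduct.inner_tmul, HTensor.inner_tprod, HTensor.inner_tprod]

variable [IsTopologicalGroup G] [CompactSpace G]

open Classical in
/-- The functional on the vertex space at `v`, for a choice of a basis vector at each edge. -/
def vertexFunctional (ρ : E → Λ.Label) (a : E → G) (v : V)
    (k : ∀ e, Fin (Module.finrank ℂ (Λ.space (ρ e)))) : VertexSpace Λ φ ρ v →ₗ[ℂ] ℂ :=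
  LinearMap.mul' ℂ ℂ ∘ₗ TensorProduct.map
    (HTensor.prodFunctional fun e : φ.S v =>
      (stdOrthonormalBasis ℂ (Λ.space (ρ e))).toBasis.coord (k e) ∘ₗ
        ((Λ.rep (ρ e)).op (a e)).toLinearEquiv.toLinearMap)
    (HTensor.prodFunctional fun e : φ.T v =>
      { toFun := fun y => (Real.sqrt (Module.finrank ℂ (Λ.space (ρ e))) : ℂ) *
          functional J y (stdOrthonormalBasis ℂ (Λ.space (ρ e)) (k e))
        map_add' := fun y y' => by rw [functional_add, add_apply, mul_add]
        map_smul' := fun c y => by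
          rw [functional_smul, smul_apply, smul_eq_mul, smul_eq_mul, mul_left_comm]
          rfl })

open Classical in
/-- The linear functional whose value at a pure tensor is `pureCoef`. -/
def coefFunctional (ρ : E → Λ.Label) (a : E → G) : HTensor (VertexSpace Λ φ ρ) →ₗ[ℂ] ℂ :=
  haveI := Fintype.ofFinite V
  ∑ k, HTensor.prodFunctional fun v => vertexFunctional φ J ρ a v k

/-- A matrix coefficient ties the source of its edge to the target. Expanding each `ρ_e(a_e)x_e` in
a basis unties them: for each choice `k` of basis indices the term is a product over vertices, that
is, a tensor product of vertex functionals. -/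
theorem coefFunctional_pureTensor (ρ : E → Λ.Label) (a : E → G) (x : ∀ e, Λ.space (ρ e))
    (y : ∀ e, Λ.space (Λ.dual (ρ e))) :
    coefFunctional φ J ρ a (pureTensor Λ φ ρ x y) = pureCoef J ρ x y a := by
  classical
  let := Fintype.ofFinite V
  have hexp : ∀ e, (Real.sqrt (Module.finrank ℂ (Λ.space (ρ e))) : ℂ) *
      functional J (y e) ((Λ.rep (ρ e)).op (a e) (x e)) =
      ∑ i, (stdOrthonormalBasis ℂ (Λ.space (ρ e))).toBasis.coord i
        ((Λ.rep (ρ e)).op (a e) (x e)) *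
        ((Real.sqrt (Module.finrank ℂ (Λ.space (ρ e))) : ℂ) *
          functional J (y e) (stdOrthonormalBasis ℂ (Λ.space (ρ e)) i)) := fun e => by
    conv_lhs => rw [← (stdOrthonormalBasis ℂ (Λ.space (ρ e))).toBasis.sum_repr
      ((Λ.rep (ρ e)).op (a e) (x e))]
    rw [map_sum, Finset.mul_sum]
    refine Finset.sum_congr rfl fun i _ => ?_
    rw [map_smul, smul_eq_mul, OrthonormalBasis.coe_toBasis, Module.Basis.coord_apply]
    ring
  rw [pureCoef, Finset.prod_congr rfl fun e _ => hexp e, Finset.prod_univ_sum,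
    Fintype.piFinset_univ, coefFunctional, LinearMap.sum_apply]
  refine Finset.sum_congr rfl fun k _ => ?_
  rw [pureTensor, HTensor.prodFunctional_tprod, Finset.prod_mul_distrib,
    ← Fintype.prod_fiberwise φ.source, ← Fintype.prod_fiberwise φ.target,
    ← Finset.prod_mul_distrib]
  refine Finset.prod_congr rfl fun v _ => ?_
  rw [vertexFunctional, LinearMap.comp_apply, pureVertex, TensorProduct.map_tmul,
    LinearMap.mul'_apply, HTensor.prodFunctional_tprod, HTensor.prodFunctional_tprod]
  rfl

/-- The linear map from tensors to functions on `G^E`. -/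
def coefMap (ρ : E → Λ.Label) : HTensor (VertexSpace Λ φ ρ) →ₗ[ℂ] ((E → G) → ℂ) :=
  LinearMap.pi (coefFunctional φ J ρ)

theorem coefMap_pureTensor (ρ : E → Λ.Label) (x : ∀ e, Λ.space (ρ e))
    (y : ∀ e, Λ.space (Λ.dual (ρ e))) :
    coefMap φ J ρ (pureTensor Λ φ ρ x y) = pureCoef J ρ x y :=
  funext fun a => coefFunctional_pureTensor φ J ρ a x y

theorem continuous_coefMap (ρ : E → Λ.Label) (t : HTensor (VertexSpace Λ φ ρ)) :
    Continuous (coefMap φ J ρ t) := by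
  induction t using pure_induction with
  | hp x y => rw [coefMap_pureTensor]; exact continuous_pureCoef J ρ x y
  | h0 => rw [map_zero]; exact continuous_zero
  | ha s t hs ht => rw [map_add]; exact hs.add ht
  | hs c t ht => rw [map_smul]; exact ht.const_smul c

theorem coefMap_gaugeAct (ρ : E → Λ.Label) (t : HTensor (VertexSpace Λ φ ρ)) (k : V → G)
    (a : E → G) : coefMap φ J ρ t (gaugeAct φ k a) =
      coefMap φ J ρ (HTensor.map (fun v => vertexOp Λ φ ρ v (k v)⁻¹) t) a := by
  induction t using pure_induction with
  | hp x y =>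
    rw [map_vertexOp_pureTensor φ ρ x y fun v => (k v)⁻¹, coefMap_pureTensor, coefMap_pureTensor,
      pureCoef_gaugeAct]
  | h0 => simp
  | ha s t hs ht => rw [map_add, map_add, map_add, Pi.add_apply, Pi.add_apply, hs, ht]
  | hs c t ht => rw [map_smul, map_smul, map_smul, Pi.smul_apply, Pi.smul_apply, ht]

/-- The functions that come from invariant tensors are gauge invariant. -/
theorem coefMap_invInclusion_gaugeAct (ρ : E → Λ.Label) (t : InvTensor Λ φ ρ) (k : V → G)
    (a : E → G) : coefMap φ J ρ (invInclusion φ ρ t) (gaugeAct φ k a) =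
      coefMap φ J ρ (invInclusion φ ρ t) a := by
  have : HTensor.map (fun v => vertexOp Λ φ ρ v (k v)⁻¹) (invInclusion φ ρ t) =
      invInclusion φ ρ t := by
    rw [invInclusion, HTensor.map_map]
    congr 2
    funext v
    ext x
    exact x.2 _
  rw [coefMap_gaugeAct, this]

/-! ### Orthogonality and completeness on `G^E` -/

section Integral

variable [MeasurableSpace G] [BorelSpace G] [SecondCountableTopology G] (μ : Measure G)
  [IsProbabilityMeasure μ]

/-- Sesquilinear forms on tensors agree if they agree on pure tensors. -/
theorem integral_coefMap_eq {ρ ρ' : E → Λ.Label}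
    (B : HTensor (VertexSpace Λ φ ρ) →ₗ⋆[ℂ] HTensor (VertexSpace Λ φ ρ') →ₗ[ℂ] ℂ)
    (hB : ∀ x y x' y', ∫ a, starRingEnd ℂ (pureCoef J ρ x y a) * pureCoef J ρ' x' y' a
      ∂(Measure.pi fun _ : E => μ) = B (pureTensor Λ φ ρ x y) (pureTensor Λ φ ρ' x' y'))
    (s : HTensor (VertexSpace Λ φ ρ)) (t : HTensor (VertexSpace Λ φ ρ')) :
    ∫ a, starRingEnd ℂ (coefMap φ J ρ s a) * coefMap φ J ρ' t a
      ∂(Measure.pi fun _ : E => μ) = B s t := by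
  have hint : ∀ s t, Integrable (fun a => starRingEnd ℂ (coefMap φ J ρ s a) *
      coefMap φ J ρ' t a) (Measure.pi fun _ : E => μ) := fun s t =>
    integrable_of_continuous _ ((Complex.continuous_conj.comp (continuous_coefMap φ J ρ s)).mul
      (continuous_coefMap φ J ρ' t))
  induction s using pure_induction with
  | h0 => simp
  | ha s s' h h' =>
    simp only [map_add, Pi.add_apply, add_mul, LinearMap.add_apply]
    rw [integral_add (hint s t) (hint s' t), h, h']
  | hs c s h =>
    simp only [map_smul, Pi.smul_apply, smul_eq_mul, map_mul, mul_assoc, LinearMap.map_smulₛₗ,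
      LinearMap.smul_apply]
    rw [integral_const_mul, h]
  | hp x y =>
    induction t using pure_induction with
    | h0 => simp
    | ha t t' h h' =>
      simp only [map_add, Pi.add_apply, mul_add]
      rw [integral_add (hint _ t) (hint _ t'), h, h']
    | hs c t h =>
      simp only [map_smul, Pi.smul_apply, smul_eq_mul, mul_left_comm _ c]
      rw [integral_const_mul, h]
    | hp x' y' => rw [coefMap_pureTensor, coefMap_pureTensor, hB]

variable [μ.IsHaarMeasure]

theorem integral_coefMap (ρ : E → Λ.Label) (s t : HTensor (VertexSpace Λ φ ρ)) :
    ∫ a, starRingEnd ℂ (coefMap φ J ρ s a) * coefMap φ J ρ t a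
      ∂(Measure.pi fun _ : E => μ) = ⟪s, t⟫_ℂ :=
  integral_coefMap_eq φ J μ (innerₛₗ ℂ) (fun x y x' y' => by
    rw [integral_pureCoef, innerₛₗ_apply_apply, inner_pureTensor]) s t

theorem integral_coefMap_of_ne {ρ ρ' : E → Λ.Label} (h : ρ ≠ ρ')
    (s : HTensor (VertexSpace Λ φ ρ)) (t : HTensor (VertexSpace Λ φ ρ')) :
    ∫ a, starRingEnd ℂ (coefMap φ J ρ s a) * coefMap φ J ρ' t a
      ∂(Measure.pi fun _ : E => μ) = 0 :=
  integral_coefMap_eq φ J μ 0 (fun x y x' y' => integral_pureCoef_of_ne J μ h x y x' y') s t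

/-- A gauge-invariant square-integrable function that is orthogonal to all functions that come
from invariant tensors vanishes. -/
theorem ae_eq_zero_of_orthogonal [T2Space G] {f : (E → G) → ℂ}
    (hf : MemLp f 2 (Measure.pi fun _ : E => μ)) (hinv : ∀ k a, f (gaugeAct φ k a) = f a)
    (h0 : ∀ ρ (ι : ∀ v, Inv Λ φ ρ v), ∫ a, starRingEnd ℂ (f a) *
      coefMap φ J ρ (HTensor.tprod fun v => (ι v).1) a ∂(Measure.pi fun _ : E => μ) = 0) :
    f =ᵐ[Measure.pi fun _ : E => μ] 0 := by
  have hint : ∀ ρ t, Integrable (fun a => starRingEnd ℂ (f a) * coefMap φ J ρ t a)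
      (Measure.pi fun _ : E => μ) := fun ρ t => by
    have h1 : MemLp (coefMap φ J ρ t) 2 (Measure.pi fun _ : E => μ) :=
      (continuous_coefMap φ J ρ t).memLp_of_hasCompactSupport (HasCompactSupport.of_compactSpace _)
    exact hf.star.integrable_mul h1
  -- Pairing with `f`, as a functional on all tensors. It is gauge invariant because both `f` and
  -- the measure are, so vanishing on invariants forces it to vanish.
  let F : ∀ ρ, HTensor (VertexSpace Λ φ ρ) →ₗ[ℂ] ℂ := fun ρ =>
    { toFun := fun t => ∫ a, starRingEnd ℂ (f a) * coefMap φ J ρ t a ∂(Measure.pi fun _ : E => μ)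
      map_add' := fun s t => by
        simp only [map_add, Pi.add_apply, mul_add]
        exact integral_add (hint ρ s) (hint ρ t)
      map_smul' := fun c t => by
        simp only [map_smul, Pi.smul_apply, smul_eq_mul, mul_left_comm _ c]
        exact integral_const_mul _ _ }
  have hF : ∀ ρ, F ρ = 0 := fun ρ => by
    refine eq_zero_of_forall_inv Λ φ ρ (fun k t => ?_) (h0 ρ)
    -- `coefMap_gaugeAct` puts inverses on the tensor side, so the change of variables is by `k⁻¹`.
    have hk : HTensor.map (fun v => vertexOp Λ φ ρ v (k v)) t =
        HTensor.map (fun v => vertexOp Λ φ ρ v ((k⁻¹ v)⁻¹)) t := by simp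
    have hmp := measurePreserving_gaugeAct φ μ k⁻¹
    change ∫ a, starRingEnd ℂ (f a) * _ ∂_ = ∫ a, starRingEnd ℂ (f a) * _ ∂_
    rw [hk]
    conv_rhs => rw [← hmp.map_eq]
    rw [integral_map hmp.measurable.aemeasurable
      (by rw [hmp.map_eq]; exact (hint ρ t).aestronglyMeasurable)]
    congr 1
    ext a
    rw [hinv, coefMap_gaugeAct]
  have hz : hf.toLp f = 0 := by
    refine UnitaryRep.eq_zero_of_orthogonal_prod_coef μ Λ _ fun ρ y x => ?_
    choose y' hy' using fun e => rieszJ_surjective J (y e)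
    let c : ℂ := ∏ e, (Real.sqrt (Module.finrank ℂ (Λ.space (ρ e))) : ℂ)
    have hc : c ≠ 0 := Finset.prod_ne_zero_iff.2 fun e _ => by
      have := (Λ.irreducible (ρ e)).1
      have : 0 < Module.finrank ℂ (Λ.space (ρ e)) := Module.finrank_pos
      exact Complex.ofReal_ne_zero.2 (Real.sqrt_ne_zero'.2 (Nat.cast_pos.2 this))
    have hp : ∀ a, pureCoef J ρ x y' a = c * ∏ e, (Λ.rep (ρ e)).coef (y e) (x e) (a e) := by
      intro a
      rw [pureCoef, Finset.prod_mul_distrib]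
      simp only [functional_apply, hy']
      rfl
    have h1 : ∫ a, starRingEnd ℂ (f a) * coefMap φ J ρ (pureTensor Λ φ ρ x y') a
        ∂(Measure.pi fun _ : E => μ) = 0 := LinearMap.congr_fun (hF ρ) _
    simp only [coefMap_pureTensor, hp, mul_left_comm _ c] at h1
    rw [integral_const_mul, mul_eq_zero, or_iff_right hc] at h1
    have h2 := congrArg (starRingEnd ℂ) h1
    rw [← integral_conj, map_zero] at h2
    rw [← h2]
    refine integral_congr_ae ?_
    filter_upwards [hf.coeFn_toLp] with a ha
    rw [ha, map_mul, Complex.conj_conj, mul_comm]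
  exact (hf.coeFn_toLp).symm.trans (by rw [hz]; exact Lp.coeFn_zero _ _ _)

end Integral

end CoefMap

/-! ### Connections and gauge transformations in coordinates -/

namespace PrincipalBundle

variable {𝔤 : Type*} [NormedAddCommGroup 𝔤] [NormedSpace ℝ 𝔤]
  {G : Type*} [Group G] [TopologicalSpace G] [ChartedSpace 𝔤 G] {V E : Type*}
  {P : PrincipalBundle 𝔤 G V} (φ : DiGraph V E)

instance (v w : V) : BorelSpace (P.EquivariantMap v w) := ⟨rfl⟩

theorem measurable_toModGauge : Measurable (P.toModGauge φ) := measurable_quotient_mk''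

namespace Trivialization

variable (τ σ : P.Trivialization)

/-- The identification of `𝒜` with `G^E` by the trivialization `τ`. -/
def coords (A : P.Connection φ) : E → G := fun e => τ.toGroup (A e)

theorem measurable_coords [MeasurableSpace G] [BorelSpace G] : Measurable (τ.coords φ) := by
  refine measurable_pi_lambda _ fun e => ?_
  have h : Continuous fun F : P.EquivariantMap (φ.source e) (φ.target e) => τ.toGroup F :=
    (τ.chart _).continuous.comp ((continuous_apply _).comp continuous_induced_dom)
  exact h.measurable.comp (measurable_pi_apply e)

/-- The transition function of two trivializations. -/
def transition (v : V) : G := τ.chart v ((σ.chart v).symm 1)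

theorem chart_eq_transition_mul (v : V) (x : P.fiber v) :
    τ.chart v x = τ.transition σ v * σ.chart v x := by
  have h : x = MulOpposite.op (σ.chart v x) • (σ.chart v).symm 1 := by
    refine (σ.chart v).injective ?_
    change σ.chart v x = σ.chart v _
    rw [σ.equivariant]
    simp
  conv_lhs => rw [h, τ.equivariant]
  rfl

/-- A change of trivialization multiplies each chart on the left by the transition function, so in
coordinates it cannot be told from a gauge transformation. All independence of the trivialization
comes from here. -/
theorem coords_eq_gaugeAct (A : P.Connection φ) :
    τ.coords φ A = gaugeAct φ (τ.transition σ) (σ.coords φ A) := by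
  funext e
  rw [gaugeAct, eq_mul_inv_iff_mul_eq, coords, coords, transition, ← toGroup_mul,
    chart_eq_transition_mul τ σ, toGroup]

theorem coords_smul (g : P.Gauge) (A : P.Connection φ) :
    τ.coords φ (g • A) =
      gaugeAct φ (fun v => τ.chart v ((g v).1 ((τ.chart v).symm 1))) (τ.coords φ A) := by
  funext e
  have hg : ∀ v x, τ.chart v ((g v).1 x) = τ.chart v ((g v).1 ((τ.chart v).symm 1)) *
      τ.chart v x := fun v x =>
    τ.toGroup_mul (v := v) (w := v) ⟨(g v).1, (g v).2.1, (g v).2.2.2⟩ x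
  rw [gaugeAct, eq_mul_inv_iff_mul_eq]
  simp only [coords]
  rw [← toGroup_mul]
  change τ.chart _ ((g _).1 ((A e).1 ((g _).1.symm ((g _).1 _)))) = _
  rw [Equiv.symm_apply_apply, hg]
  rfl

variable [LieGroup 𝓘(ℝ, 𝔤) ∞ G]

theorem coords_connection (a : E → G) : τ.coords φ (τ.connection φ a) = a :=
  funext fun e => τ.toGroup_ofGroup _ _ (a e)

theorem connection_coords (A : P.Connection φ) : τ.connection φ (τ.coords φ A) = A := by
  funext e
  refine Subtype.ext (funext fun x => (τ.chart _).injective ?_)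
  change τ.chart _ ((τ.chart _).symm (τ.toGroup (A e) * τ.chart _ x)) = τ.chart _ ((A e).1 x)
  rw [toGroup_mul]
  exact (τ.chart _).apply_symm_apply _

theorem measurable_connection [IsTopologicalGroup G] [MeasurableSpace G] [BorelSpace G] :
    Measurable (τ.connection φ) := by
  refine measurable_pi_lambda _ fun e => ?_
  have h : Continuous (τ.ofGroup (φ.source e) (φ.target e)) :=
    continuous_induced_rng.2 (continuous_pi fun x =>
      (τ.chart _).symm.continuous.comp (continuous_mul_const _))
  exact h.measurable.comp (measurable_pi_apply e)

/-- The gauge transformation that is left multiplication by `k` in the trivialization `τ`. -/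
def gauge (k : V → G) : P.Gauge := fun v =>
  ⟨{ toFun := (τ.ofGroup v v (k v)).1
     invFun := (τ.ofGroup v v (k v)⁻¹).1
     left_inv := fun x => (τ.chart v).injective (by simp [ofGroup])
     right_inv := fun x => (τ.chart v).injective (by simp [ofGroup]) },
    (τ.ofGroup v v (k v)).2.1, (τ.ofGroup v v (k v)⁻¹).2.1, (τ.ofGroup v v (k v)).2.2⟩

theorem coords_gauge_smul (k : V → G) (A : P.Connection φ) :
    τ.coords φ (τ.gauge k • A) = gaugeAct φ k (τ.coords φ A) := by
  rw [coords_smul]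
  congr 1
  funext v
  exact τ.toGroup_ofGroup v v (k v)

theorem toModGauge_connection_gaugeAct (k : V → G) (a : E → G) :
    P.toModGauge φ (τ.connection φ (gaugeAct φ k a)) =
      P.toModGauge φ (τ.connection φ a) := by
  refine Quotient.sound (MulAction.orbitRel_apply.2 ⟨τ.gauge k, ?_⟩)
  change τ.gauge k • τ.connection φ a = _
  rw [← connection_coords φ τ (τ.gauge k • τ.connection φ a), coords_gauge_smul,
    coords_connection]

variable [Fintype E] [IsTopologicalGroup G] [CompactSpace G] [MeasurableSpace G] [BorelSpace G]

instance : IsProbabilityMeasure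
    (Measure.haarMeasure (⊤ : TopologicalSpace.PositiveCompacts G)) :=
  ⟨Measure.haarMeasure_self⟩

theorem measurePreserving_connection : MeasurePreserving (τ.connection φ)
    (Measure.pi fun _ : E => Measure.haarMeasure (⊤ : TopologicalSpace.PositiveCompacts G))
    (τ.measure φ) :=
  ⟨τ.measurable_connection φ, rfl⟩

/-- The measure on `𝒜` does not depend on the trivialization. -/
theorem measure_eq_measure : τ.measure φ = σ.measure φ := by
  have h : τ.connection φ = σ.connection φ ∘ gaugeAct φ (σ.transition τ) := funext fun a => by
    have := σ.coords_eq_gaugeAct φ τ (τ.connection φ a)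
    rw [coords_connection] at this
    rw [Function.comp_apply, ← this, connection_coords]
  have hmp := measurePreserving_gaugeAct φ
    (Measure.haarMeasure (⊤ : TopologicalSpace.PositiveCompacts G)) (σ.transition τ)
  rw [measure, h, ← Measure.map_map (σ.measurable_connection φ) hmp.measurable, hmp.map_eq]
  rfl

theorem measure_eq : τ.measure φ = P.measure φ := τ.measure_eq_measure φ _

/-- The map `G^E → 𝒜/𝒢`. -/
def proj (a : E → G) : P.ConnectionModGauge φ := P.toModGauge φ (τ.connection φ a)

/-- This lets norms and inner products in `L²(𝒜/𝒢)` be computed on `G^E`. -/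
theorem measurePreserving_proj : MeasurePreserving (τ.proj φ)
    (Measure.pi fun _ : E => Measure.haarMeasure (⊤ : TopologicalSpace.PositiveCompacts G))
    ((P.measure φ).map (P.toModGauge φ)) := by
  rw [← τ.measure_eq]
  exact (Measurable.measurePreserving (measurable_toModGauge φ) _).comp
    (τ.measurePreserving_connection φ)

end Trivialization

/-! ### Spin network functions on `𝒜/𝒢` -/

section SpinNetworks

variable [Fintype E] [Finite V] [IsTopologicalGroup G] [CompactSpace G] {Λ : IrrepSet.{u, w} G}
  (J : ∀ l, (Λ.rep (Λ.dual l)).Equivalence (Λ.rep l).dual) (τ : P.Trivialization)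

/-- The function on `𝒜/𝒢` that belongs to a tensor product of invariants. -/
def spinFunction (ρ : E → Λ.Label) (t : InvTensor Λ φ ρ) : P.ConnectionModGauge φ → ℂ :=
  Quotient.lift (fun A => coefMap φ J ρ (invInclusion φ ρ t) (τ.coords φ A)) fun A B h => by
    obtain ⟨g, rfl⟩ := MulAction.orbitRel_apply.1 h
    dsimp only
    rw [Trivialization.coords_smul, coefMap_invInclusion_gaugeAct]

/-- The function is built with `τ` but computed with any `σ`, since the two coordinates differ by a
gauge transformation. This gives the independence in (2). -/
theorem spinFunction_toModGauge (σ : P.Trivialization) (ρ : E → Λ.Label) (t : InvTensor Λ φ ρ)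
    (A : P.Connection φ) : spinFunction φ J τ ρ t (P.toModGauge φ A) =
      coefMap φ J ρ (invInclusion φ ρ t) (σ.coords φ A) := by
  rw [σ.coords_eq_gaugeAct φ τ, coefMap_invInclusion_gaugeAct]
  rfl

theorem spinFunction_proj [LieGroup 𝓘(ℝ, 𝔤) ∞ G] (ρ : E → Λ.Label) (t : InvTensor Λ φ ρ) (a : E → G) :
    spinFunction φ J τ ρ t (τ.proj φ a) = coefMap φ J ρ (invInclusion φ ρ t) a := by
  rw [Trivialization.proj, spinFunction_toModGauge φ J τ τ, Trivialization.coords_connection]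

variable [MeasurableSpace G] [BorelSpace G] [SecondCountableTopology G]

theorem measurable_spinFunction (ρ : E → Λ.Label) (t : InvTensor Λ φ ρ) :
    Measurable (spinFunction φ J τ ρ t) :=
  measurable_from_quotient.2
    ((continuous_coefMap φ J ρ _).measurable.comp (τ.measurable_coords φ))

variable [LieGroup 𝓘(ℝ, 𝔤) ∞ G]

theorem memLp_spinFunction (ρ : E → Λ.Label) (t : InvTensor Λ φ ρ) :
    MemLp (spinFunction φ J τ ρ t) 2 ((P.measure φ).map (P.toModGauge φ)) := by
  rw [← (τ.measurePreserving_proj φ).map_eq, memLp_map_measure_iff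
    (measurable_spinFunction φ J τ ρ t).aestronglyMeasurable
    (τ.measurePreserving_proj φ).measurable.aemeasurable]
  refine ((continuous_coefMap φ J ρ (invInclusion φ ρ t)).memLp_of_hasCompactSupport
    (HasCompactSupport.of_compactSpace _)).ae_eq (Filter.Eventually.of_forall fun a => ?_)
  exact (spinFunction_proj φ J τ ρ t a).symm

/-- The linear map from the tensor product of the invariants to `L²(𝒜/𝒢)`. -/
def spinLinearMap (ρ : E → Λ.Label) : InvTensor Λ φ ρ →ₗ[ℂ] P.L2ModGauge φ where
  toFun t := (memLp_spinFunction φ J τ ρ t).toLp _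
  map_add' s t := by
    rw [← MemLp.toLp_add]
    refine MemLp.toLp_congr _ _ (Filter.Eventually.of_forall fun q => ?_)
    induction q using Quotient.inductionOn with
    | h A => exact congrFun (((coefMap φ J ρ).comp (invInclusion φ ρ)).map_add s t) _
  map_smul' c t := by
    rw [RingHom.id_apply, ← MemLp.toLp_const_smul]
    refine MemLp.toLp_congr _ _ (Filter.Eventually.of_forall fun q => ?_)
    induction q using Quotient.inductionOn with
    | h A => exact congrFun (((coefMap φ J ρ).comp (invInclusion φ ρ)).map_smul c t) _

theorem inner_spinLinearMap_left (ρ : E → Λ.Label) (t : InvTensor Λ φ ρ) (f : P.L2ModGauge φ) :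
    ⟪f, spinLinearMap φ J τ ρ t⟫_ℂ =
      ∫ a, starRingEnd ℂ (f (τ.proj φ a)) * coefMap φ J ρ (invInclusion φ ρ t) a
        ∂(Measure.pi fun _ : E => Measure.haarMeasure (⊤ : TopologicalSpace.PositiveCompacts G)) := by
  have h1 : ∀ᵐ q ∂((P.measure φ).map (P.toModGauge φ)),
      ⟪f q, spinLinearMap φ J τ ρ t q⟫_ℂ = starRingEnd ℂ (f q) * spinFunction φ J τ ρ t q := by
    filter_upwards [(memLp_spinFunction φ J τ ρ t).coeFn_toLp] with q hq
    rw [RCLike.inner_apply', ← hq]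
    rfl
  have hmp := τ.measurePreserving_proj φ
  have h2 := integral_map (μ := Measure.pi fun _ : E =>
    Measure.haarMeasure (⊤ : TopologicalSpace.PositiveCompacts G)) hmp.measurable.aemeasurable
    (((Complex.continuous_conj.measurable.comp (Lp.stronglyMeasurable f).measurable).mul
      (measurable_spinFunction φ J τ ρ t)).aestronglyMeasurable)
  rw [hmp.map_eq] at h2
  rw [L2.inner_def, integral_congr_ae h1]
  refine h2.trans ?_
  simp only [Pi.mul_apply, Function.comp_apply, spinFunction_proj]

theorem inner_spinLinearMap (ρ ρ' : E → Λ.Label) (s : InvTensor Λ φ ρ) (t : InvTensor Λ φ ρ') :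
    ⟪spinLinearMap φ J τ ρ s, spinLinearMap φ J τ ρ' t⟫_ℂ =
      ∫ a, starRingEnd ℂ (coefMap φ J ρ (invInclusion φ ρ s) a) *
        coefMap φ J ρ' (invInclusion φ ρ' t) a
        ∂(Measure.pi fun _ : E => Measure.haarMeasure (⊤ : TopologicalSpace.PositiveCompacts G)) := by
  rw [inner_spinLinearMap_left]
  refine integral_congr_ae ?_
  filter_upwards [(τ.measurePreserving_proj φ).quasiMeasurePreserving.ae
    (memLp_spinFunction φ J τ ρ s).coeFn_toLp] with a ha
  rw [← spinFunction_proj φ J τ ρ s, ← ha]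
  rfl

/-- The isometry from the tensor product of the invariants to `L²(𝒜/𝒢)`. -/
def spinIsometry (ρ : E → Λ.Label) : InvTensor Λ φ ρ →ₗᵢ[ℂ] P.L2ModGauge φ :=
  (spinLinearMap φ J τ ρ).isometryOfInner fun s t => by
    rw [inner_spinLinearMap, integral_coefMap, inner_invInclusion]

theorem orthogonalFamily_spinIsometry :
    OrthogonalFamily ℂ (InvTensor Λ φ) (spinIsometry φ J τ) := fun ρ ρ' h s t =>
  (inner_spinLinearMap φ J τ ρ ρ' s t).trans (integral_coefMap_of_ne φ J _ h _ _)

/-- A function orthogonal to all ranges pulls back to a gauge-invariant function on `G^E`, to which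
`ae_eq_zero_of_orthogonal` applies. -/
theorem iSup_range_spinIsometry [T2Space G] :
    ⊤ ≤ (⨆ ρ, LinearMap.range (spinIsometry φ J τ ρ).toLinearMap).topologicalClosure := by
  rw [top_le_iff, Submodule.topologicalClosure_eq_top_iff, Submodule.eq_bot_iff]
  intro f hf
  have h0 : ∀ ρ t, ⟪f, spinLinearMap φ J τ ρ t⟫_ℂ = 0 := fun ρ t =>
    Submodule.inner_left_of_mem_orthogonal
      (Submodule.mem_iSup_of_mem (p := fun ρ => LinearMap.range (spinIsometry φ J τ ρ).toLinearMap)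
        ρ ⟨t, rfl⟩) hf
  have hmp := τ.measurePreserving_proj φ
  have hz := ae_eq_zero_of_orthogonal φ J
    (Measure.haarMeasure (⊤ : TopologicalSpace.PositiveCompacts G))
    (f := fun a => f (τ.proj φ a)) ((Lp.memLp f).comp_measurePreserving hmp)
    (fun k a => by rw [Trivialization.proj, Trivialization.toModGauge_connection_gaugeAct]; rfl)
    fun ρ ι => by rw [← invInclusion_tprod, ← inner_spinLinearMap_left, h0]
  have h1 := (ae_map_iff hmp.measurable.aemeasurable (measurableSet_eq_fun
    (Lp.stronglyMeasurable f).measurable measurable_const)).2 hz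
  rw [hmp.map_eq] at h1
  exact (Lp.eq_zero_iff_ae_eq_zero).2 h1

theorem isHilbertSum_spinIsometry [T2Space G] :
    IsHilbertSum ℂ (InvTensor Λ φ) (spinIsometry φ J τ) :=
  haveI : ∀ ρ, CompleteSpace (InvTensor Λ φ ρ) := fun _ => FiniteDimensional.complete ℂ _
  IsHilbertSum.mk (orthogonalFamily_spinIsometry φ J τ) (iSup_range_spinIsometry φ J τ)

end SpinNetworks

end PrincipalBundle

theorem _root_.HilbertBasis.span_range_eq_top {ι H : Type*} [NormedAddCommGroup H]
    [InnerProductSpace ℂ H] [FiniteDimensional ℂ H] (b : HilbertBasis ι ℂ H) :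
    Submodule.span ℂ (Set.range b) = ⊤ := by
  rw [← b.dense_span,
    (Submodule.closed_of_finiteDimensional _).submodule_topologicalClosure_eq]

end SpinNet

end

/-! ### Assembly of the theorem -/

theorem mainTheorem3
    {𝔤 : Type*} [NormedAddCommGroup 𝔤] [NormedSpace ℝ 𝔤] [FiniteDimensional ℝ 𝔤]
    {G : Type*} [Group G] [TopologicalSpace G] [ChartedSpace 𝔤 G] [LieGroup 𝓘(ℝ, 𝔤) ∞ G]
    [IsTopologicalGroup G] [T2Space G] [CompactSpace G] [MeasurableSpace G] [BorelSpace G]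
    {V E : Type*} [Fintype V] [Fintype E] (φ : SpinNet.DiGraph V E)
    (P : SpinNet.PrincipalBundle 𝔤 G V) (Λ : SpinNet.IrrepSet G)
    (J : ∀ l, (Λ.rep (Λ.dual l)).Equivalence (Λ.rep l).dual) :
    (∀ τ : P.Trivialization, τ.measure φ = P.measure φ) ∧
    ∃ U : P.L2ModGauge φ ≃ₗᵢ[ℂ] SpinNet.SpinNetworkSpace Λ φ,
      (∀ (τ : P.Trivialization) (ρ : E → Λ.Label),
        ∃ L : SpinNet.HTensor (SpinNet.VertexSpace Λ φ ρ) →ₗ[ℂ] (P.Connection φ → ℂ),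
          SpinNet.IsMatrixCoefficientMap Λ φ τ J ρ L ∧
          ∀ ι : ∀ v, SpinNet.Inv Λ φ ρ v,
            (fun A => U.symm (SpinNet.spinNetwork Λ φ ρ ι) (P.toModGauge φ A))
              =ᵐ[P.measure φ] L (SpinNet.HTensor.tprod fun v => (ι v).1)) ∧
      ∀ (κ : (E → Λ.Label) → V → Type*)
        (b : ∀ ρ v, HilbertBasis (κ ρ v) ℂ (SpinNet.Inv Λ φ ρ v)),
        ∃ B : HilbertBasis (Σ ρ : E → Λ.Label, ∀ v, κ ρ v) ℂ (P.L2ModGauge φ),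
          ∀ (ρ : E → Λ.Label) (i : ∀ v, κ ρ v),
            B ⟨ρ, i⟩ = U.symm (SpinNet.spinNetwork Λ φ ρ fun v => b ρ v (i v)) := by
  classical
  -- A compact manifold modelled on a finite-dimensional space is second countable, so the product
  -- σ-algebra on `G^E` is the Borel one.
  have : ProperSpace 𝔤 := FiniteDimensional.proper ℝ 𝔤
  have : SecondCountableTopology G := ChartedSpace.secondCountable_of_sigmaCompact 𝔤 G
  obtain ⟨τ₀⟩ := P.nonempty_trivialization
  have hH := SpinNet.PrincipalBundle.isHilbertSum_spinIsometry φ J τ₀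
  have hU : ∀ ρ ι, hH.linearIsometryEquiv.symm (SpinNet.spinNetwork Λ φ ρ ι) =
      SpinNet.PrincipalBundle.spinIsometry φ J τ₀ ρ (SpinNet.HTensor.tprod ι) := fun ρ ι => by
    rw [SpinNet.spinNetwork]
    convert hH.linearIsometryEquiv_symm_apply_single _
  refine ⟨fun τ => τ.measure_eq φ, hH.linearIsometryEquiv, fun τ ρ => ?_, fun κ b => ?_⟩
  · refine ⟨LinearMap.funLeft ℂ ℂ (τ.coords φ) ∘ₗ SpinNet.coefMap φ J ρ, fun x y A =>
      congrFun (SpinNet.coefMap_pureTensor φ J ρ x y) (τ.coords φ A), fun ι => ?_⟩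
    filter_upwards [ae_of_ae_map (SpinNet.PrincipalBundle.measurable_toModGauge φ).aemeasurable
      (SpinNet.PrincipalBundle.memLp_spinFunction φ J τ₀ ρ (SpinNet.HTensor.tprod ι)).coeFn_toLp]
      with A hA
    rw [hU]
    refine hA.trans ?_
    rw [SpinNet.PrincipalBundle.spinFunction_toModGauge φ J τ₀ τ, SpinNet.invInclusion_tprod]
    rfl
  · have ho : ∀ ρ, Orthonormal ℂ fun i : ∀ v, κ ρ v =>
        (SpinNet.HTensor.tprod fun v => b ρ v (i v) : SpinNet.InvTensor Λ φ ρ) := fun ρ =>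
      SpinNet.HTensor.orthonormal_tprod (H := fun v => SpinNet.Inv Λ φ ρ v)
        (b := fun v => b ρ v) fun v => (b ρ v).orthonormal
    have hS := hH.OrthogonalFamily.orthonormal_sigma_orthonormal ho
    -- `Inv(v,ρ)` is finite-dimensional, so its Hilbert basis spans it algebraically, and pure
    -- tensors of basis vectors span each summand.
    have hspan : (⨆ ρ, LinearMap.range
        (SpinNet.PrincipalBundle.spinIsometry φ J τ₀ ρ).toLinearMap) ≤
        Submodule.span ℂ (Set.range fun a : Σ ρ : E → Λ.Label, ∀ v, κ ρ v =>
          SpinNet.PrincipalBundle.spinIsometry φ J τ₀ a.1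
            (SpinNet.HTensor.tprod fun v => b a.1 v (a.2 v))) := by
      refine iSup_le fun ρ => ?_
      have htop := SpinNet.HTensor.span_tprod_eq_top (H := fun v => SpinNet.Inv Λ φ ρ v)
        (fun v => Set.range (b ρ v)) fun v => (b ρ v).span_range_eq_top
      rw [LinearMap.range_eq_map, ← htop, Submodule.map_span]
      refine Submodule.span_mono ?_
      rintro _ ⟨_, ⟨x, hx, rfl⟩, rfl⟩
      choose i hi using hx
      refine ⟨⟨ρ, i⟩, ?_⟩
      simp only [hi]
      rfl
    refine ⟨HilbertBasis.mk hS ((SpinNet.PrincipalBundle.iSup_range_spinIsometry φ J τ₀).trans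
      (Submodule.topologicalClosure_mono hspan)), fun ρ i => ?_⟩
    rw [HilbertBasis.coe_mk, hU]
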